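/- **Setting.** Let $\Gamma$ be an almost normal subgroup of a discrete group $G$, i.e. $[\Gamma:\sigma\Gamma\sigma^{-1}\cap\Gamma]<\infty$ for all $\sigma\in G$. Let $\pi$ be a unitary representation of $G$ on a Hilbert space $H$ or, more generally, a projective one: $\pi(e)=1$ and $\pi(g)\pi(h)=c(g,h)\pi(gh)$ with a normalised circle-valued 2-cocycle $c$ ($c\equiv1$ for ordinary representations). Let $L\subseteq H$ be a closed subspace that is $\Gamma$-wandering ($\pi(\gamma)L\perp L$ for $\gamma\in\Gamma\setminus\{e\}$) and generating ($\bigcup_{\gamma\in\Gamma}\pi(\gamma)L$ spans a dense subspace of $H$), so that $H\cong\ell^2(\Gamma)\otimes L$ and $\pi|_\Gamma=\lambda_\Gamma\otimes\mathrm{Id}_L$ ($c$-twisted if $c\not\equiv 1$ on $\Gamma$). Let $H_0\subseteq H$ be a closed $\pi(G)$-invariant subspace, $p$ the orthogonal projection of $H$ onto $H_0$, $\pi_0(g)=\pi(g)|_{H_0}$, and $P_L$ the orthogonal projection onto $L$. Assume that $pP_L$ is trace class. **Algebras.** On $\ell^2(G)\otimes L=\ell^2(G,L)$ put $\big((\rho(\theta^{-1})\otimes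 A)\xi\big)(g)=\overline{c(g,\theta)}\,A\,\xi(g\theta)$ for $\theta\in G$, $A\in B(L)$; for $c\equiv1$ this is right translation $\delta_h\mapsto\delta_{h\theta^{-1}}$ tensor $A$. For a subgroup $\Lambda\subseteq G$ let $R(\Lambda)\otimes B(L)$ be the von Neumann algebra on $\ell^2(G)\otimes L$ generated by all $\rho(\lambda^{-1})\otimes A$, $\lambda\in\Lambda$, $A\in B(L)$, with the trace $\tau\otimes\mathrm{Tr}$, $\tau(x)=\langle x\delta_e,\delta_e\rangle$. Let $\mathcal H_0=\mathbb C(\Gamma\backslash G/\Gamma)$ be the Hecke algebra, realised as the span of the indicator functions of the double cosets $\Gamma\sigma\Gamma$, with $(f*h)(x)=\sum_{y\Gamma\in G/\Gamma}f(y)h(y^{-1}x)$ and $f^*(x)=\overline{f(x^{-1})}$. For $f\in\mathcal H_0$ and $X\in\pi_0(\Gamma)'$ consider $$S(f)=\sum_{\theta\in G}f(\theta)\,\rho(\theta^{-1})\otimes P_L\pi(\theta)P_L,\qquad \Phi(X)=\sum_{\gamma\in\Gamma}\rho(\gamma^{-1})\otimes P_L\pi_0(\gamma)XP_L ,$$ and,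 writing $p$ also for $\Phi(1)$, put $S_p(f)=p\,S(f)\,p$; write $S_p(\Gamma\sigma\Gamma)$ when $f$ is the indicator function of $\Gamma\sigma\Gamma$. The classical Hecke operator on $\pi_0(\Gamma)'$ is $$\Psi_{[\Gamma\sigma\Gamma]}(X)=\sum_i\pi_0(s_i)X\pi_0(s_i)^{-1},\qquad \Gamma\sigma\Gamma=\bigsqcup_i s_i\Gamma .$$ **Theorem.** 1. The series for $S(f)$ and $\Phi(X)$ converge (unconditionally, coordinatewise at every vector) to bounded operators, and $S(f)\in R(G)\otimes B(L)$. The operator $p=\Phi(1)$ is a projection in $R(\Gamma)\otimes B(L)$, and $\Phi$ is a $*$-isomorphism of $\pi_0(\Gamma)'$ onto $p(R(\Gamma)\otimes B(L))p$. 2. $S_p$ is a unital $*$-representation of $\mathcal H_0$ in $p(R(G)\otimes B(L))p$, and $S_p(f)=\sum_\theta f(\theta)\,\rho(\theta^{-1})\otimes P_L\pi_0(\theta)P_L$ in the same sense. 3. The trace $\tau\otimes\mathrm{Tr}$ is finite on $p(R(G)\otimes B(L))p$, and there is a unique trace-preserving conditional expectation $E$ of $p(R(G)\otimes B(L))p$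 onto $p(R(\Gamma)\otimes B(L))p$. 4. For all $\sigma\in G$ and all $X\in\pi_0(\Gamma)'\cong p(R(\Gamma)\otimes B(L))p$ (identified by $\Phi$), $\Psi_{[\Gamma\sigma\Gamma]}(X)\in\pi_0(\Gamma)'$ and $$E\big(S_p(\Gamma\sigma\Gamma)\,X\,S_p(\Gamma\sigma\Gamma)^*\big)=\Psi_{[\Gamma\sigma\Gamma]}(X).$$ In particular, if $\Gamma\sigma\Gamma=\Gamma\sigma^{-1}\Gamma$, then $$E\big(S_p(\Gamma\sigma\Gamma)\,X\,S_p(\Gamma\sigma\Gamma)\big)=\Psi_{[\Gamma\sigma\Gamma]}(X).$$ -/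

import Mathlib

open scoped Pointwise

universe u v

namespace HeckeVN

noncomputable section

/-- A projective unitary representation `g ↦ π(g)` of `G` on the Hilbert space `H`, normalised by
`π(e) = 1`, with its circle-valued 2-cocycle: `π(g) π(h) = c(g, h) π(gh)`. An ordinary unitary
representation is the case `c = 1`. (The laws of `c` follow from those of `π` when `H ≠ 0`.) -/
structure ProjUnitaryRep (G : Type v) [Group G] (H : Type u) [NormedAddCommGroup H]
    [InnerProductSpace ℂ H] [CompleteSpace H] where
  /-- the unitary operators `π(g)` -/
  op : G → unitary (H →L[ℂ] H)
  /-- the 2-cocycle -/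
  cocycle : G → G → Circle
  op_one : op 1 = 1
  op_mul : ∀ g h, (op g : H →L[ℂ] H) * (op h : H →L[ℂ] H) =
    (cocycle g h : ℂ) • (op (g * h) : H →L[ℂ] H)
  cocycle_one_left : ∀ g, cocycle 1 g = 1
  cocycle_one_right : ∀ g, cocycle g 1 = 1
  cocycle_assoc : ∀ g h k,
    cocycle g h * cocycle (g * h) k = cocycle g (h * k) * cocycle h k

section Group

variable {G : Type v} [Group G]

/-- `Γ` is almost normal in `G`: `[Γ : σΓσ⁻¹ ∩ Γ] < ∞` for all `σ`. -/
def IsAlmostNormal (Γ : Subgroup G) : Prop :=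
  ∀ σ : G, (MulAut.conj σ • Γ).relIndex Γ ≠ 0

/-- The double coset `ΓσΓ`, as a subset of `G`. -/
def dcoset (Γ : Subgroup G) (σ : G) : Set G := DoubleCoset.doubleCoset σ (Γ : Set G) (Γ : Set G)

/-- The double coset `[ΓσΓ]` as an element of the Hecke algebra: the indicator function of `ΓσΓ`. -/
def dcosetFun (Γ : Subgroup G) (σ : G) : G → ℂ := (dcoset Γ σ).indicator 1

/-- The Hecke algebra `ℂ(Γ\G/Γ)`, the complex vector space with basis the double cosets, realised
as a space of bi-`Γ`-invariant functions on `G`. -/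
def heckeSpace (Γ : Subgroup G) : Submodule ℂ (G → ℂ) :=
  Submodule.span ℂ (Set.range (dcosetFun Γ))

/-- The product of the Hecke algebra: `(f * h)(x) = ∑_{yΓ ∈ G/Γ} f(y) h(y⁻¹x)`. -/
def heckeMul (Γ : Subgroup G) (f h : G → ℂ) : G → ℂ :=
  fun x => ∑ᶠ y : G ⧸ Γ, f y.out * h (y.out⁻¹ * x)

/-- The involution of the Hecke algebra: `f*(x) = conj (f (x⁻¹))`, so `[ΓσΓ]* = [Γσ⁻¹Γ]`. -/
def heckeStar (f : G → ℂ) : G → ℂ := fun x => star (f x⁻¹)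

end Group

section RightRegular

variable {G : Type v} [Group G] {V : Type u} [NormedAddCommGroup V] [InnerProductSpace ℂ V]

/-- The Hilbert space `ℓ²(G) ⊗ V`, that is `ℓ²(G, V)`. -/
abbrev L2 (G : Type v) (V : Type u) [NormedAddCommGroup V] : Type (max u v) :=
  lp (fun _ : G => V) 2

theorem sum_translate_le (c : G → G → Circle) (θ : G) (A : V →L[ℂ] V) (ξ : L2 G V)
    (s : Finset G) :
    ∑ g ∈ s, ‖(((c g θ)⁻¹ : Circle) : ℂ) • A (ξ (g * θ))‖ ^ (2 : ENNReal).toReal ≤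
      (‖A‖ * ‖ξ‖) ^ (2 : ENNReal).toReal := by
  classical
  have h2 : (0 : ℝ) < (2 : ENNReal).toReal := by norm_num
  calc ∑ g ∈ s, ‖(((c g θ)⁻¹ : Circle) : ℂ) • A (ξ (g * θ))‖ ^ (2 : ENNReal).toReal
      ≤ ∑ g ∈ s, ‖A‖ ^ (2 : ENNReal).toReal * ‖ξ (g * θ)‖ ^ (2 : ENNReal).toReal := by
        refine Finset.sum_le_sum fun g _ => ?_
        rw [norm_smul, Circle.norm_coe, one_mul, ← Real.mul_rpow (norm_nonneg _) (norm_nonneg _)]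
        exact Real.rpow_le_rpow (norm_nonneg _) (A.le_opNorm _) h2.le
    _ = ‖A‖ ^ (2 : ENNReal).toReal *
          ∑ g ∈ s.map (Equiv.mulRight θ).toEmbedding, ‖ξ g‖ ^ (2 : ENNReal).toReal := by
        rw [Finset.sum_map, Finset.mul_sum]; rfl
    _ ≤ ‖A‖ ^ (2 : ENNReal).toReal * ‖ξ‖ ^ (2 : ENNReal).toReal :=
        mul_le_mul_of_nonneg_left (lp.sum_rpow_le_norm_rpow h2 ξ _)
          (Real.rpow_nonneg (norm_nonneg _) _)
    _ = (‖A‖ * ‖ξ‖) ^ (2 : ENNReal).toReal :=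
        (Real.mul_rpow (norm_nonneg _) (norm_nonneg _)).symm

/-- The operator `ρ(θ⁻¹) ⊗ A` on `ℓ²(G) ⊗ V`, where `ρ(θ⁻¹)` is the right translation
`δ_h ↦ δ_{hθ⁻¹}`, twisted by the inverse of the cocycle `c`:
`(ρ(θ⁻¹) ⊗ A)(ξ)(g) = c(g, θ)⁻¹ A (ξ(gθ))`. For `c = 1` this is the right regular
representation of `G`. -/
def rightTensor (c : G → G → Circle) (θ : G) (A : V →L[ℂ] V) : L2 G V →L[ℂ] L2 G V :=
  LinearMap.mkContinuous
    { toFun := fun ξ => ⟨fun g => (((c g θ)⁻¹ : Circle) : ℂ) • A (ξ (g * θ)),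
        memℓp_gen' (sum_translate_le c θ A ξ)⟩
      map_add' := fun ξ η => by
        ext g
        change (((c g θ)⁻¹ : Circle) : ℂ) • A ((ξ + η : L2 G V) (g * θ)) =
          (((c g θ)⁻¹ : Circle) : ℂ) • A (ξ (g * θ)) + (((c g θ)⁻¹ : Circle) : ℂ) • A (η (g * θ))
        rw [lp.coeFn_add, Pi.add_apply, map_add, smul_add]
      map_smul' := fun a ξ => by
        ext g
        simp [smul_comm a] }
    ‖A‖
    (fun ξ => lp.norm_le_of_forall_sum_le (by norm_num)
      (mul_nonneg (norm_nonneg _) (norm_nonneg _)) (sum_translate_le c θ A ξ))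

theorem rightTensor_apply (c : G → G → Circle) (θ : G) (A : V →L[ℂ] V) (ξ : L2 G V) (g : G) :
    rightTensor c θ A ξ g = (((c g θ)⁻¹ : Circle) : ℂ) • A (ξ (g * θ)) := rfl

/-- `T` is the sum of the formal series `∑_θ ρ(θ⁻¹) ⊗ A_θ`: the bounded operator `T` on
`ℓ²(G) ⊗ V` is given by the series, which converges unconditionally at every vector, coordinate by
coordinate. -/
def IsSeries (c : G → G → Circle) (A : G → V →L[ℂ] V) (T : L2 G V →L[ℂ] L2 G V) : Prop :=
  ∀ (ξ : L2 G V) (g : G), HasSum (fun θ => rightTensor c θ (A θ) ξ g) (T ξ g)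

open Classical in
/-- The bounded operator on `ℓ²(G) ⊗ V` given by the formal series `∑_θ ρ(θ⁻¹) ⊗ A_θ`
(and `0` if the series does not define a bounded operator). -/
def seriesOp (c : G → G → Circle) (A : G → V →L[ℂ] V) : L2 G V →L[ℂ] L2 G V :=
  if h : ∃ T, IsSeries c A T then h.choose else 0

/-- The functional `τ ⊗ Tr` on operators on `ℓ²(G) ⊗ V`, where `τ(x) = ⟨x δ_e, δ_e⟩`:
`(τ ⊗ Tr)(x) = t` means that `∑_i ⟨x (δ_e ⊗ b_i), δ_e ⊗ b_i⟩` converges to `t` for every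
orthonormal basis `b` of `V`. -/
def HasTrace (x : L2 G V →L[ℂ] L2 G V) (t : ℂ) : Prop :=
  open Classical in
  ∀ (ι : Type u) (b : HilbertBasis ι ℂ V),
    HasSum (fun i => inner ℂ (lp.single 2 (1 : G) (b i) : L2 G V)
      (x (lp.single 2 (1 : G) (b i)))) t

variable [CompleteSpace V]

/-- The von Neumann algebra `R(Γ) ⊗ B(V)` acting on `ℓ²(G) ⊗ V`: the double commutant of the
operators `ρ(γ⁻¹) ⊗ A`, `γ ∈ Γ`, `A ∈ B(V)`. For `Γ = ⊤` it is `R(G) ⊗ B(V)`. -/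
def rightAlg (c : G → G → Circle) (V : Type u) [NormedAddCommGroup V] [InnerProductSpace ℂ V]
    [CompleteSpace V] (Γ : Subgroup G) : StarSubalgebra ℂ (L2 G V →L[ℂ] L2 G V) :=
  StarSubalgebra.centralizer ℂ
    (StarSubalgebra.centralizer ℂ
      {T : L2 G V →L[ℂ] L2 G V | ∃ γ ∈ Γ, ∃ A : V →L[ℂ] V, T = rightTensor c γ A} :
        Set (L2 G V →L[ℂ] L2 G V))

end RightRegular

section Algebra

variable {B : Type u} [Ring B] [StarRing B] [Algebra ℂ B] [StarModule ℂ B]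

/-- The corner `e M e` of an algebra `M`. -/
def corner (e : B) (M : StarSubalgebra ℂ B) : Submodule ℂ B where
  carrier := {x | ∃ y ∈ M, x = e * y * e}
  add_mem' := by
    rintro _ _ ⟨y, hy, rfl⟩ ⟨z, hz, rfl⟩
    exact ⟨y + z, add_mem hy hz, by rw [mul_add, add_mul]⟩
  zero_mem' := ⟨0, zero_mem M, by simp⟩
  smul_mem' := by
    rintro a _ ⟨y, hy, rfl⟩
    exact ⟨a • y, M.smul_mem hy a, by simp⟩

end Algebra

/-- `E : M → N` is a conditional expectation of the algebra `M` of operators on `ℓ²(G) ⊗ V` onto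
its subalgebra `N` preserving the trace `τ ⊗ Tr`. -/
structure IsCondExp {G : Type v} [Group G] {V : Type u} [NormedAddCommGroup V]
    [InnerProductSpace ℂ V] [CompleteSpace V] (M N : Submodule ℂ (L2 G V →L[ℂ] L2 G V))
    (E : M →ₗ[ℂ] N) : Prop where
  map_of_mem : ∀ x : M, (x : L2 G V →L[ℂ] L2 G V) ∈ N →
    (E x : L2 G V →L[ℂ] L2 G V) = (x : L2 G V →L[ℂ] L2 G V)
  bimodule : ∀ a ∈ N, ∀ b ∈ N, ∀ x y : M,
    (y : L2 G V →L[ℂ] L2 G V) = a * (x : L2 G V →L[ℂ] L2 G V) * b →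
    (E y : L2 G V →L[ℂ] L2 G V) = a * (E x : L2 G V →L[ℂ] L2 G V) * b
  positive : ∀ x : M, (x : L2 G V →L[ℂ] L2 G V).IsPositive →
    (E x : L2 G V →L[ℂ] L2 G V).IsPositive
  trace : ∀ (x : M) (t : ℂ), HasTrace (x : L2 G V →L[ℂ] L2 G V) t →
    HasTrace (E x : L2 G V →L[ℂ] L2 G V) t

section Rep

variable {G : Type v} [Group G] {H : Type u} [NormedAddCommGroup H] [InnerProductSpace ℂ H]
  [CompleteSpace H]

/-- `T` is trace class: `∑_i ⟨|T| b_i, b_i⟩ < ∞` for an orthonormal basis `b`, where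
`|T| = (T*T)^{1/2}`. -/
def IsTraceClass (T : H →L[ℂ] H) : Prop :=
  ∃ (ι : Type u) (b : HilbertBasis ι ℂ H),
    Summable fun i => (inner ℂ (b i) (CFC.abs T (b i))).re

/-- The restriction `π₀(g) = π(g)|_{H₀}` of `π` to an invariant closed subspace `H₀`. -/
def ProjUnitaryRep.restrict (π : ProjUnitaryRep G H) (H₀ : Submodule ℂ H) [CompleteSpace H₀]
    (hinv : ∀ g, ∀ x ∈ H₀, (π.op g : H →L[ℂ] H) x ∈ H₀) : ProjUnitaryRep G H₀ := by
  let r : G → H₀ →L[ℂ] H₀ := fun g =>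
    ((π.op g : H →L[ℂ] H) ∘L H₀.subtypeL).codRestrict H₀ fun x => hinv g x x.2
  have r_apply : ∀ g (x : H₀), ((r g x : H₀) : H) = (π.op g : H →L[ℂ] H) x := fun g x => rfl
  have r_one : r 1 = 1 := by
    ext x
    simp [r_apply, π.op_one]
  have r_mul : ∀ g h, r g * r h = (π.cocycle g h : ℂ) • r (g * h) := by
    intro g h
    ext x
    have := congrArg (fun T : H →L[ℂ] H => T (x : H)) (π.op_mul g h)
    simpa [r_apply] using this
  have r_iso : ∀ g, star (r g) * r g = 1 := by
    intro g
    ext x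
    refine congrArg Subtype.val (ext_inner_right ℂ fun y => ?_)
    rw [mul_apply_eq_comp, ContinuousLinearMap.star_eq_adjoint,
      ContinuousLinearMap.adjoint_inner_left, Submodule.coe_inner, r_apply, r_apply,
      ← ContinuousLinearMap.adjoint_inner_left, ← ContinuousLinearMap.star_eq_adjoint,
      ← mul_apply_eq_comp, Unitary.coe_star_mul_self]
    rfl
  have r_unit : ∀ g, r g * star (r g) = 1 := by
    intro g
    have h1 : r g * ((π.cocycle g g⁻¹ : ℂ)⁻¹ • r g⁻¹) = 1 := by
      have h2 : r g * ((π.cocycle g g⁻¹ : ℂ)⁻¹ • r g⁻¹) =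
          (π.cocycle g g⁻¹ : ℂ)⁻¹ • (r g * r g⁻¹) := by
        ext x
        simp
      rw [h2, r_mul, mul_inv_cancel, r_one, smul_smul,
        inv_mul_cancel₀ (Circle.coe_ne_zero _), one_smul]
    rw [left_inv_eq_right_inv (r_iso g) h1, h1]
  exact
    { op := fun g => ⟨r g, Unitary.mem_iff.2 ⟨r_iso g, r_unit g⟩⟩
      cocycle := π.cocycle
      op_one := Subtype.ext r_one
      op_mul := r_mul
      cocycle_one_left := π.cocycle_one_left
      cocycle_one_right := π.cocycle_one_right
      cocycle_assoc := π.cocycle_assoc }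

theorem ProjUnitaryRep.restrict_op_apply (π : ProjUnitaryRep G H) (H₀ : Submodule ℂ H)
    [CompleteSpace H₀] (hinv : ∀ g, ∀ x ∈ H₀, (π.op g : H →L[ℂ] H) x ∈ H₀) (g : G) (x : H₀) :
    ((((π.restrict H₀ hinv).op g : H₀ →L[ℂ] H₀) x : H₀) : H) = (π.op g : H →L[ℂ] H) x := rfl

/-- The commutant `π(Γ)'`. -/
def ProjUnitaryRep.commutant (π : ProjUnitaryRep G H) (Γ : Subgroup G) :
    StarSubalgebra ℂ (H →L[ℂ] H) :=
  StarSubalgebra.centralizer ℂ {T : H →L[ℂ] H | ∃ γ ∈ Γ, T = (π.op γ : H →L[ℂ] H)}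

/-- The classical Hecke operator `Ψ_{[ΓσΓ]}(X) = ∑_i π(s_i) X π(s_i)⁻¹`, where `ΓσΓ` is the
disjoint union of the cosets `s_i Γ` (for `X ∈ π(Γ)'` the choice of the `s_i` is irrelevant). -/
def ProjUnitaryRep.classicalHecke (π : ProjUnitaryRep G H) (Γ : Subgroup G) (σ : G)
    (X : H →L[ℂ] H) : H →L[ℂ] H :=
  ∑ᶠ y : {y : G ⧸ Γ // y.out ∈ dcoset Γ σ},
    (π.op y.1.out : H →L[ℂ] H) * X * star (π.op y.1.out : H →L[ℂ] H)

variable (π : ProjUnitaryRep G H) (L H₀ : Submodule ℂ H) [CompleteSpace L] [CompleteSpace H₀]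

/-- `P_L T P_L`, as an operator on `L`, for an operator `T` on `H`. -/
def compress (T : H →L[ℂ] H) : L →L[ℂ] L :=
  L.orthogonalProjectionOnto ∘L T ∘L L.subtypeL

/-- `P_L T P_L`, as an operator on `L`, for an operator `T` on `H₀`
(extended by `0` to the orthogonal complement of `H₀`). -/
def compress₀ (T : H₀ →L[ℂ] H₀) : L →L[ℂ] L :=
  compress L (H₀.subtypeL ∘L T ∘L H₀.orthogonalProjectionOnto)

/-- The representation `S` of the Hecke algebra associated with the splitting `L`:
`S(f) = ∑_θ f(θ) ρ(θ⁻¹) ⊗ P_L π(θ) P_L`, so that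
`S(ΓσΓ) = ∑_{θ ∈ ΓσΓ} ρ(θ⁻¹) ⊗ P_L π(θ) P_L`. -/
def splitHecke (f : G → ℂ) : L2 G L →L[ℂ] L2 G L :=
  seriesOp π.cocycle fun θ => f θ • compress L (π.op θ : H →L[ℂ] H)

variable (hinv : ∀ g, ∀ x ∈ H₀, (π.op g : H →L[ℂ] H) x ∈ H₀) (Γ : Subgroup G)

open Classical in
/-- The coefficients of the series `∑_{γ ∈ Γ} ρ(γ⁻¹) ⊗ P_L π₀(γ) X P_L`. -/
def commutantCoeff (X : H₀ →L[ℂ] H₀) (θ : G) : L →L[ℂ] L :=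
  if θ ∈ Γ then compress₀ L H₀ (((π.restrict H₀ hinv).op θ : H₀ →L[ℂ] H₀) * X) else 0

/-- The identification of `π₀(Γ)'` with `p(R(Γ) ⊗ B(L))p`:
`X ↦ ∑_{γ ∈ Γ} ρ(γ⁻¹) ⊗ P_L π₀(γ) X P_L`. -/
def commutantMap (X : H₀ →L[ℂ] H₀) : L2 G L →L[ℂ] L2 G L :=
  seriesOp π.cocycle (commutantCoeff π L H₀ hinv Γ X)

/-- The projection `p`, as an element of `R(Γ) ⊗ B(L)`:
`p = ∑_{γ ∈ Γ} ρ(γ⁻¹) ⊗ P_L π₀(γ) P_L`. -/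
def cutProj : L2 G L →L[ℂ] L2 G L := commutantMap π L H₀ hinv Γ 1

/-- The reduced representation `S_p(f) = p S(f) p` of the Hecke algebra. -/
def reducedHecke (f : G → ℂ) : L2 G L →L[ℂ] L2 G L :=
  cutProj π L H₀ hinv Γ * splitHecke π L f * cutProj π L H₀ hinv Γ

/-- The reduced algebra `p(R(Λ) ⊗ B(L))p`, for a subgroup `Λ` of `G`; the projection `p` is that
of the group `Γ`. -/
def reducedAlg (Λ : Subgroup G) : Submodule ℂ (L2 G L →L[ℂ] L2 G L) :=
  corner (cutProj π L H₀ hinv Γ) (rightAlg π.cocycle L Λ)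

end Rep

end

end HeckeVN

/-! Everything becomes transparent after a change of picture. Since `L` is wandering and generating
for `Γ`, the map `δ_g ⊗ v ↦ δ_{gΓ} ⊗ π(g)v` extends to a unitary from `ℓ²(G) ⊗ L` onto `ℓ²(G/Γ) ⊗ H`
(`IsSplitting.isHilbertSum`, `IsSplitting.toL2`). A matrix entry of a formal series involves `P_L
π(g)* π(k) P_L`, and the cocycle produced by `π(g)* π(k)` is exactly the twist in `rightTensor`.
Hence on `ℓ²(G/Γ) ⊗ H` the operator `S(f)` is the scalar Hecke matrix `(f(g⁻¹k))` tensored with the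
identity of `H`, `Φ(X)` is block diagonal with blocks `π(k) X π(k)*`, and `p` has all diagonal
blocks equal to the projection onto `H₀`. Boundedness of the series and the representation property
of `S` and `S_p` can be read off from this.

The other tool is `IsSplitting.block`, the diagonal block at the trivial coset. Elements of `R(Γ) ⊗
B(L)` preserve that fibre, so `block` is multiplicative against them. They also commute with the
left translations, which move the fibre everywhere, so `block` is injective on them
(`IsSplitting.block_injOn`). This makes `Φ` a `*`-isomorphism whose inverse is the compression of
the block to `H₀`, and `E = Φ ∘ compress ∘ block` is the conditional expectation: the trace sees
only the block (`IsSplitting.hasTrace_iff`). The trace is finite because `pP_L` is Hilbert–Schmidt,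
and faithful because `δ_e ⊗ L` is separating; together these give uniqueness of `E`.

The Hecke formula is then one matrix product: the block of `S(ΓσΓ) Φ(X) S(ΓσΓ)*` at the trivial
coset is the sum of `π(w) X π(w)*` over the cosets `wΓ` in `ΓσΓ` (`block_splitHecke_conj`). -/

namespace HeckeVN

noncomputable section

open scoped Classical

/-! ### Operators on `ℓ²(ι, E)` given by matrices -/

section MatrixOperators

variable {ι : Type*} [DecidableEq ι] {E : Type*} [NormedAddCommGroup E] [InnerProductSpace ℂ E]

theorem hasSum_eval {F : Type*} [NormedAddCommGroup F] [InnerProductSpace ℂ F] {κ α : Type*}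
    {f : α → lp (fun _ : κ => F) 2} {s : lp (fun _ : κ => F) 2} (h : HasSum f s) (k : κ) :
    HasSum (fun a => f a k) (s k) :=
  h.mapL (lp.evalCLM ℂ (fun _ : κ => F) 2 k)

theorem hasSum_apply_single {F : Type*} [NormedAddCommGroup F] [InnerProductSpace ℂ F]
    (T : lp (fun _ : ι => E) 2 →L[ℂ] F) (η : lp (fun _ : ι => E) 2) :
    HasSum (fun i => T (lp.single 2 i (η i))) (T η) :=
  (lp.hasSum_single (by norm_num) η).mapL T

theorem ext_single {F : Type*} [NormedAddCommGroup F] [InnerProductSpace ℂ F]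
    {T T' : lp (fun _ : ι => E) 2 →L[ℂ] F}
    (h : ∀ i x, T (lp.single 2 i x) = T' (lp.single 2 i x)) : T = T' := by
  ext η
  refine (hasSum_apply_single T η).unique ?_
  simpa only [h] using hasSum_apply_single T' η

/-- Cauchy–Schwarz on a row with at most `n` terms costs a factor `n`; after exchanging the sums,
each column contributes at most `m` entries of size `C²`. This is where `√(nm) C` comes from. -/
theorem sum_matrix_le (X : ι → ι → E →L[ℂ] E) {C : ℝ} {n m : ℕ} (R S : ι → Finset ι)
    (hRn : ∀ i, (R i).card ≤ n) (hS : ∀ i j, X i j ≠ 0 → i ∈ S j)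
    (hSm : ∀ j, (S j).card ≤ m) (hC : ∀ i j, ‖X i j‖ ≤ C) (η : lp (fun _ : ι => E) 2)
    (s : Finset ι) :
    ∑ i ∈ s, ‖∑ j ∈ R i, X i j (η j)‖ ^ (2 : ENNReal).toReal ≤
      (Real.sqrt (n * m) * C * ‖η‖) ^ (2 : ENNReal).toReal := by
  have h2 : (2 : ENNReal).toReal = ((2 : ℕ) : ℝ) := by norm_num
  have hη := fun t : Finset ι => lp.sum_rpow_le_norm_rpow (p := 2) (by norm_num) η t
  simp only [h2, Real.rpow_natCast] at hη ⊢
  let Z := s.biUnion R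
  have hrow : ∀ i ∈ s, ‖∑ j ∈ R i, X i j (η j)‖ ^ 2 ≤
      n * ∑ j ∈ Z, ‖X i j‖ ^ 2 * ‖η j‖ ^ 2 := by
    intro i hi
    calc ‖∑ j ∈ R i, X i j (η j)‖ ^ 2 ≤ (∑ j ∈ R i, ‖X i j (η j)‖) ^ 2 := by
          gcongr; exact norm_sum_le _ _
      _ ≤ (R i).card * ∑ j ∈ R i, ‖X i j (η j)‖ ^ 2 := sq_sum_le_card_mul_sum_sq
      _ ≤ n * ∑ j ∈ R i, ‖X i j‖ ^ 2 * ‖η j‖ ^ 2 := by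
          gcongr with j hj
          · exact hRn i
          · rw [← mul_pow]; gcongr; exact (X i j).le_opNorm _
      _ ≤ n * ∑ j ∈ Z, ‖X i j‖ ^ 2 * ‖η j‖ ^ 2 := by
          gcongr
          exact Finset.subset_biUnion_of_mem R hi
  have hcol : ∀ j, ∑ i ∈ s, ‖X i j‖ ^ 2 ≤ m * C ^ 2 := by
    intro j
    calc ∑ i ∈ s, ‖X i j‖ ^ 2 = ∑ i ∈ s with i ∈ S j, ‖X i j‖ ^ 2 := by
          rw [Finset.sum_filter]
          refine Finset.sum_congr rfl fun i _ => ?_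
          split_ifs with h
          · rfl
          · have : X i j = 0 := by by_contra h'; exact h (hS i j h')
            simp [this]
      _ ≤ ∑ i ∈ s with i ∈ S j, C ^ 2 := by
          gcongr with i hi
          exact hC i j
      _ = ((s.filter (· ∈ S j)).card : ℝ) * C ^ 2 := by simp
      _ ≤ m * C ^ 2 := by
          gcongr
          exact (Finset.card_le_card fun i hi => (Finset.mem_filter.1 hi).2).trans (hSm j)
  calc ∑ i ∈ s, ‖∑ j ∈ R i, X i j (η j)‖ ^ 2
      ≤ ∑ i ∈ s, n * ∑ j ∈ Z, ‖X i j‖ ^ 2 * ‖η j‖ ^ 2 := Finset.sum_le_sum hrow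
    _ = n * ∑ j ∈ Z, (∑ i ∈ s, ‖X i j‖ ^ 2) * ‖η j‖ ^ 2 := by
        rw [← Finset.mul_sum, Finset.sum_comm]
        simp_rw [Finset.sum_mul]
    _ ≤ n * ∑ j ∈ Z, (m * C ^ 2) * ‖η j‖ ^ 2 := by
        gcongr with j hj
        exact hcol j
    _ = n * (m * C ^ 2) * ∑ j ∈ Z, ‖η j‖ ^ 2 := by rw [← Finset.mul_sum]; ring
    _ ≤ n * (m * C ^ 2) * ‖η‖ ^ 2 := by gcongr; exact hη Z
    _ = (Real.sqrt (n * m) * C * ‖η‖) ^ 2 := by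
        rw [mul_pow, mul_pow, Real.sq_sqrt (by positivity)]; ring

/-- A uniformly bounded matrix of operators whose rows and columns have boundedly many nonzero
entries defines a bounded operator. -/
theorem exists_matrix_operator (X : ι → ι → E →L[ℂ] E) {C : ℝ} {n m : ℕ} (R S : ι → Finset ι)
    (hR : ∀ i j, X i j ≠ 0 → j ∈ R i) (hRn : ∀ i, (R i).card ≤ n)
    (hS : ∀ i j, X i j ≠ 0 → i ∈ S j) (hSm : ∀ j, (S j).card ≤ m)
    (hC : ∀ i j, ‖X i j‖ ≤ C) :
    ∃ T : lp (fun _ : ι => E) 2 →L[ℂ] lp (fun _ : ι => E) 2,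
      ∀ j x i, T (lp.single 2 j x) i = X i j x := by
  -- The bound `0 ≤ C` is deduced from an actual entry, so the empty matrix is treated apart.
  rcases isEmpty_or_nonempty ι with hι | ⟨⟨i₀⟩⟩
  · exact ⟨0, fun j => (IsEmpty.false j).elim⟩
  have hC0 : 0 ≤ C := (norm_nonneg _).trans (hC i₀ i₀)
  have key := sum_matrix_le X R S hRn hS hSm hC
  refine ⟨LinearMap.mkContinuous
    { toFun := fun η => ⟨fun i => ∑ j ∈ R i, X i j (η j), memℓp_gen' (key η)⟩
      map_add' := fun η ζ => by
        ext i
        simp only [lp.coeFn_add, Pi.add_apply, map_add, Finset.sum_add_distrib]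
      map_smul' := fun a η => by
        ext i
        simp [Finset.smul_sum] } (Real.sqrt (n * m) * C)
      (fun η => lp.norm_le_of_forall_sum_le (by norm_num) (by positivity) (key η)), ?_⟩
  intro j x i
  change ∑ k ∈ R i, X i k ((lp.single 2 j x : lp (fun _ : ι => E) 2) k) = X i j x
  rw [Finset.sum_eq_single j]
  · simp
  · intro k _ hk
    rw [lp.single_apply_ne _ _ _ hk, map_zero]
  · intro h
    have : X i j = 0 := by by_contra h'; exact h (hR i j h')
    simp [this]

/-- Bounded diagonal matrices of operators. -/
theorem exists_diagonal_operator (X : ι → E →L[ℂ] E) {C : ℝ} (hC0 : 0 ≤ C)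
    (hC : ∀ i, ‖X i‖ ≤ C) :
    ∃ T : lp (fun _ : ι => E) 2 →L[ℂ] lp (fun _ : ι => E) 2,
      ∀ j x, T (lp.single 2 j x) = lp.single 2 j (X j x) := by
  obtain ⟨T, hT⟩ := exists_matrix_operator (fun i j => if i = j then X j else 0) (C := C)
    (n := 1) (m := 1) (fun i => {i}) (fun i => {i})
    (fun i j h => by by_contra h'; exact h (if_neg fun e => h' (by simp [e]))) (fun _ => by simp)
    (fun i j h => by by_contra h'; exact h (if_neg fun e => h' (by simp [e]))) (fun _ => by simp)
    (fun i j => by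
      split_ifs
      · exact hC j
      · simpa using hC0)
  refine ⟨T, fun j x => ?_⟩
  ext i
  rw [hT]
  by_cases h : i = j
  · subst h; simp
  · rw [if_neg h, lp.single_apply_ne _ _ _ h]; rfl

variable [CompleteSpace E]

theorem inner_star_single (T : lp (fun _ : ι => E) 2 →L[ℂ] lp (fun _ : ι => E) 2) (i j : ι)
    (x y : E) :
    inner ℂ (star T (lp.single 2 j x) i) y = inner ℂ x (T (lp.single 2 i y) j) := by
  rw [← lp.inner_single_right, ContinuousLinearMap.star_eq_adjoint,
    ContinuousLinearMap.adjoint_inner_left, lp.inner_single_left]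

end MatrixOperators

/-! ### Formal series and the algebras `R(Λ) ⊗ B(V)` -/

section Series

variable {G : Type v} [Group G] {V : Type u} [NormedAddCommGroup V] [InnerProductSpace ℂ V]

/-- Only `θ = g⁻¹k` moves `δ_k` to `δ_g`. Conversely, substituting `k = gθ` in the expansion of `T
ξ` at `g` recovers the series, so a bounded operator with the right matrix entries is automatically
its sum, and convergence needs no separate argument. -/
theorem isSeries_iff (c : G → G → Circle) (A : G → V →L[ℂ] V) (T : L2 G V →L[ℂ] L2 G V) :
    IsSeries c A T ↔ ∀ k v g, T (lp.single 2 k v) g =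
      (((c g (g⁻¹ * k))⁻¹ : Circle) : ℂ) • A (g⁻¹ * k) v := by
  constructor
  · intro h k v g
    have h1 := hasSum_single (f := fun θ => rightTensor c θ (A θ) (lp.single 2 k v) g) (g⁻¹ * k) ?_
    · refine (h (lp.single 2 k v) g).unique ?_
      rw [rightTensor_apply, mul_inv_cancel_left, lp.single_apply_self] at h1
      exact h1
    · intro θ hθ
      rw [rightTensor_apply, lp.single_apply_ne, map_zero, smul_zero]
      rintro rfl
      simp at hθ
  · intro h ξ g
    have h1 := hasSum_eval (hasSum_apply_single T ξ) g
    rw [← (Equiv.mulLeft g).hasSum_iff] at h1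
    convert! h1 using 2 with θ
    simp [h, rightTensor_apply]

theorem IsSeries.unique {c : G → G → Circle} {A : G → V →L[ℂ] V} {T T' : L2 G V →L[ℂ] L2 G V}
    (h : IsSeries c A T) (h' : IsSeries c A T') : T = T' := by
  ext ξ g
  exact (h ξ g).unique (h' ξ g)

theorem IsSeries.seriesOp_eq {c : G → G → Circle} {A : G → V →L[ℂ] V}
    {T : L2 G V →L[ℂ] L2 G V} (h : IsSeries c A T) : seriesOp c A = T := by
  have h' : ∃ T, IsSeries c A T := ⟨T, h⟩
  rw [seriesOp, dif_pos h']
  exact h'.choose_spec.unique h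

theorem rightTensor_single (c : G → G → Circle) (θ : G) (A : V →L[ℂ] V) (k : G) (v : V) :
    rightTensor c θ A (lp.single 2 k v) =
      lp.single 2 (k * θ⁻¹) ((((c (k * θ⁻¹) θ)⁻¹ : Circle) : ℂ) • A v) := by
  ext g
  rw [rightTensor_apply]
  by_cases h : g = k * θ⁻¹
  · subst h; simp
  · rw [lp.single_apply_ne _ _ _ h, lp.single_apply_ne, map_zero, smul_zero]
    rintro rfl
    simp at h

variable [CompleteSpace V]

theorem star_rightTensor_single (c : G → G → Circle) (θ : G) (A : V →L[ℂ] V) (k : G) (v : V) :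
    star (rightTensor c θ A) (lp.single 2 k v) =
      lp.single 2 (k * θ) ((c k θ : ℂ) • star A v) := by
  ext g
  refine ext_inner_right ℂ fun w : V => ?_
  rw [inner_star_single, rightTensor_apply]
  by_cases h : g = k * θ
  · subst h
    rw [lp.single_apply_self, lp.single_apply_self, ContinuousLinearMap.star_eq_adjoint,
      inner_smul_left, inner_smul_right, ContinuousLinearMap.adjoint_inner_left,
      Circle.coe_inv_eq_conj]
  · rw [lp.single_apply_ne _ _ _ (Ne.symm h), lp.single_apply_ne _ _ _ h]
    simp

theorem commute_rightTensor_of_mem_centralizer {c : G → G → Circle} {Λ : Subgroup G}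
    {T : L2 G V →L[ℂ] L2 G V}
    (hT : T ∈ StarSubalgebra.centralizer ℂ
      {T : L2 G V →L[ℂ] L2 G V | ∃ γ ∈ Λ, ∃ A : V →L[ℂ] V, T = rightTensor c γ A})
    {θ : G} (hθ : θ ∈ Λ) (A : V →L[ℂ] V) : rightTensor c θ A * T = T * rightTensor c θ A :=
  ((StarSubalgebra.mem_centralizer_iff ℂ).1 hT _ ⟨θ, hθ, A, rfl⟩).1

/-- An operator given by a series supported on `Λ` belongs to `R(Λ) ⊗ B(V)`. -/
theorem IsSeries.mem_rightAlg {c : G → G → Circle} {A : G → V →L[ℂ] V}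
    {T : L2 G V →L[ℂ] L2 G V} (h : IsSeries c A T) {Λ : Subgroup G}
    (hA : ∀ θ, θ ∉ Λ → A θ = 0) : T ∈ rightAlg c V Λ := by
  -- Both products are expanded at one coordinate: `T(W δ_k)` by the series, and `W(T δ_k)` by
  -- decomposing `T δ_k` into its coordinates `kθ⁻¹`. The terms agree because `W` commutes with each
  -- term of the series.
  have key : ∀ W ∈ StarSubalgebra.centralizer ℂ
      {T : L2 G V →L[ℂ] L2 G V | ∃ γ ∈ Λ, ∃ A : V →L[ℂ] V, T = rightTensor c γ A},
      W * T = T * W := by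
    intro W hW
    refine ext_single fun k v => ?_
    ext g
    have hcomm : ∀ θ, rightTensor c θ (A θ) * W = W * rightTensor c θ (A θ) := by
      intro θ
      by_cases hθ : θ ∈ Λ
      · exact commute_rightTensor_of_mem_centralizer hW hθ _
      · have : rightTensor c θ (0 : V →L[ℂ] V) = 0 := by
          ext ξ g
          simp [rightTensor_apply]
        rw [hA θ hθ, this, zero_mul, mul_zero]
    have h1 := h (W (lp.single 2 k v)) g
    have h2 := hasSum_eval (hasSum_apply_single W (T (lp.single 2 k v))) g
    rw [← ((Equiv.inv G).trans (Equiv.mulLeft k)).hasSum_iff] at h2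
    refine h2.unique ?_
    convert! h1 using 2 with θ
    rw [← mul_apply_eq_comp (rightTensor c θ (A θ)), hcomm θ, mul_apply_eq_comp,
      rightTensor_single]
    simp only [Function.comp_apply, Equiv.trans_apply, Equiv.inv_apply, Equiv.coe_mulLeft]
    rw [(isSeries_iff c A T).1 h]
    simp
  refine (StarSubalgebra.mem_centralizer_iff ℂ).2 fun W hW => ⟨key W hW, key _ (star_mem hW)⟩

theorem commute_of_mem_rightAlg {c : G → G → Circle} {Λ : Subgroup G}
    {T W : L2 G V →L[ℂ] L2 G V} (hT : T ∈ rightAlg c V Λ)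
    (hW : ∀ θ ∈ Λ, ∀ A : V →L[ℂ] V, rightTensor c θ A * W = W * rightTensor c θ A)
    (hW' : ∀ θ ∈ Λ, ∀ A : V →L[ℂ] V,
      star (rightTensor c θ A) * W = W * star (rightTensor c θ A)) : W * T = T * W := by
  refine ((StarSubalgebra.mem_centralizer_iff ℂ).1 hT W ?_).1
  refine (StarSubalgebra.mem_centralizer_iff ℂ).2 ?_
  rintro _ ⟨θ, hθ, A, rfl⟩
  exact ⟨hW θ hθ A, hW' θ hθ A⟩

theorem rightAlg_mono (c : G → G → Circle) {Λ Λ' : Subgroup G} (h : Λ ≤ Λ') :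
    rightAlg c V Λ ≤ rightAlg c V Λ' := by
  intro T hT
  refine (StarSubalgebra.mem_centralizer_iff ℂ).2 fun W hW => ?_
  refine (StarSubalgebra.mem_centralizer_iff ℂ).1 hT W ?_
  refine (StarSubalgebra.mem_centralizer_iff ℂ).2 ?_
  rintro _ ⟨θ, hθ, A, rfl⟩
  exact (StarSubalgebra.mem_centralizer_iff ℂ).1 hW _ ⟨θ, h hθ, A, rfl⟩

end Series

/-! ### The unitary `ℓ²(G/Γ) ⊗ H ≅ ℓ²(G) ⊗ L` -/

section Splitting

variable {G : Type v} [Group G] {H : Type u} [NormedAddCommGroup H] [InnerProductSpace ℂ H]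
  [CompleteSpace H]

namespace ProjUnitaryRep

variable (π : ProjUnitaryRep G H)

theorem op_op (g h : G) (x : H) :
    (π.op g : H →L[ℂ] H) ((π.op h : H →L[ℂ] H) x) =
      (π.cocycle g h : ℂ) • (π.op (g * h) : H →L[ℂ] H) x := by
  have := congrArg (fun T : H →L[ℂ] H => T x) (π.op_mul g h)
  simpa using this

theorem op_mul_apply (g h : G) (x : H) :
    (π.op (g * h) : H →L[ℂ] H) x =
      (((π.cocycle g h)⁻¹ : Circle) : ℂ) • (π.op g : H →L[ℂ] H) ((π.op h : H →L[ℂ] H) x) := by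
  rw [op_op, smul_smul, ← Circle.coe_mul, inv_mul_cancel, Circle.coe_one, one_smul]

theorem star_op_op_self (g : G) (x : H) :
    star (π.op g : H →L[ℂ] H) ((π.op g : H →L[ℂ] H) x) = x := by
  rw [← mul_apply_eq_comp, Unitary.coe_star_mul_self]; rfl

theorem op_star_op_self (g : G) (x : H) :
    (π.op g : H →L[ℂ] H) (star (π.op g : H →L[ℂ] H) x) = x := by
  rw [← mul_apply_eq_comp, Unitary.mul_star_self_of_mem (π.op g).2]; rfl

/-- The scalar is the one carried by the `(g, k)` entry of a twisted series in `isSeries_iff`; this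
match is what lets projective representations be treated like ordinary ones. -/
theorem star_op_op (g k : G) (x : H) :
    star (π.op g : H →L[ℂ] H) ((π.op k : H →L[ℂ] H) x) =
      (((π.cocycle g (g⁻¹ * k))⁻¹ : Circle) : ℂ) • (π.op (g⁻¹ * k) : H →L[ℂ] H) x := by
  have := π.op_mul_apply g (g⁻¹ * k) x
  rw [mul_inv_cancel_left] at this
  rw [this, map_smul, star_op_op_self]

theorem op_one_apply (x : H) : (π.op 1 : H →L[ℂ] H) x = x := by
  rw [π.op_one]; rfl

theorem inner_op_op (g : G) (x y : H) :
    inner ℂ ((π.op g : H →L[ℂ] H) x) ((π.op g : H →L[ℂ] H) y) = inner ℂ x y := by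
  rw [← ContinuousLinearMap.adjoint_inner_right, ← ContinuousLinearMap.star_eq_adjoint,
    star_op_op_self]

theorem norm_op_apply (g : G) (x : H) : ‖(π.op g : H →L[ℂ] H) x‖ = ‖x‖ := by
  rw [@norm_eq_sqrt_re_inner ℂ, @norm_eq_sqrt_re_inner ℂ, inner_op_op]

theorem norm_op_le (g : G) : ‖(π.op g : H →L[ℂ] H)‖ ≤ 1 :=
  ContinuousLinearMap.opNorm_le_bound _ zero_le_one fun x => by rw [norm_op_apply, one_mul]

end ProjUnitaryRep

/-- `L` is a `Γ`-wandering and generating subspace of `H`. -/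
structure IsSplitting (π : ProjUnitaryRep G H) (Γ : Subgroup G) (L : Submodule ℂ H) : Prop where
  wandering : ∀ γ ∈ Γ, γ ≠ 1 → ∀ x ∈ L, ∀ y ∈ L, inner ℂ ((π.op γ : H →L[ℂ] H) x) y = 0
  generating : (Submodule.span ℂ
    {z : H | ∃ γ ∈ Γ, ∃ x ∈ L, z = (π.op γ : H →L[ℂ] H) x}).topologicalClosure = ⊤

variable {π : ProjUnitaryRep G H} {Γ : Subgroup G} {L : Submodule ℂ H}

/-- The isometry `x ↦ δ_{gΓ} ⊗ π(g) x` of `L` into `ℓ²(G/Γ) ⊗ H`. -/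
def cosetIsometry (π : ProjUnitaryRep G H) (Γ : Subgroup G) (L : Submodule ℂ H) (g : G) :
    L →ₗᵢ[ℂ] lp (fun _ : G ⧸ Γ => H) 2 where
  toFun x := lp.single 2 (g : G ⧸ Γ) ((π.op g : H →L[ℂ] H) x)
  map_add' x y := by simp [lp.single_add]
  map_smul' a x := by simp [lp.single_smul]
  norm_map' x := by
    change ‖(lp.single 2 (g : G ⧸ Γ) ((π.op g : H →L[ℂ] H) x) : lp (fun _ : G ⧸ Γ => H) 2)‖ = ‖x‖
    rw [lp.norm_single (by norm_num), π.norm_op_apply]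
    rfl

theorem cosetIsometry_apply (g : G) (x : L) :
    cosetIsometry π Γ L g x = lp.single 2 (g : G ⧸ Γ) ((π.op g : H →L[ℂ] H) x) := rfl

variable [CompleteSpace L]

/-- Over distinct cosets the ranges are orthogonal for trivial reasons; over one coset, `π(h)* π(g)`
is a multiple of `π(h⁻¹g)` with `h⁻¹g ∈ Γ`, and wandering applies. The fibre over `gΓ` is filled
because the spaces `π(gγ)L` are, up to phases, the image under `π(g)` of a total family. -/
theorem IsSplitting.isHilbertSum (hS : IsSplitting π Γ L) :
    IsHilbertSum ℂ (fun _ : G => L) (cosetIsometry π Γ L) := by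
  refine IsHilbertSum.mk ?_ ?_
  · intro g h hgh v w
    change inner ℂ (cosetIsometry π Γ L g v) (cosetIsometry π Γ L h w) = 0
    rw [cosetIsometry_apply, cosetIsometry_apply, lp.inner_single_left]
    by_cases hq : (g : G ⧸ Γ) = h
    · rw [hq, lp.single_apply_self]
      have hmem : h⁻¹ * g ∈ Γ := QuotientGroup.eq.1 hq.symm
      rw [← ContinuousLinearMap.adjoint_inner_left, ← ContinuousLinearMap.star_eq_adjoint,
        π.star_op_op, inner_smul_left, hS.wandering _ hmem ?_ v v.2 w w.2, mul_zero]
      intro h1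
      exact hgh (inv_mul_eq_one.1 h1).symm
    · rw [lp.single_apply_ne _ _ _ hq, inner_zero_right]
  · set W := (⨆ g, LinearMap.range (cosetIsometry π Γ L g).toLinearMap).topologicalClosure
    have hW : ∀ g (v : L), cosetIsometry π Γ L g v ∈ W := fun g v =>
      Submodule.le_topologicalClosure _ (Submodule.mem_iSup_of_mem g ⟨v, rfl⟩)
    have hsingle : ∀ (y : G ⧸ Γ) (x : H), (lp.single 2 y x : lp (fun _ : G ⧸ Γ => H) 2) ∈ W := by
      intro y x
      obtain ⟨g, rfl⟩ := QuotientGroup.mk_surjective y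
      let A : H →L[ℂ] lp (fun _ : G ⧸ Γ => H) 2 :=
        lp.singleContinuousLinearMap ℂ (fun _ : G ⧸ Γ => H) 2 (g : G ⧸ Γ) ∘L
          (π.op g : H →L[ℂ] H)
      -- The pullback of `W` to `H` is closed and contains every `π(γ)L`, so generation makes it all
      -- of `H`; surjectivity of `π(g)` then covers the whole fibre.
      have hle : (⊤ : Submodule ℂ H) ≤ W.comap A.toLinearMap := by
        rw [← hS.generating]
        refine Submodule.topologicalClosure_minimal _ ?_ ?_
        · rw [Submodule.span_le]
          rintro _ ⟨γ, hγ, z, hz, rfl⟩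
          change lp.single 2 (g : G ⧸ Γ) ((π.op g : H →L[ℂ] H) ((π.op γ : H →L[ℂ] H) z)) ∈ W
          rw [π.op_op, lp.single_smul]
          refine W.smul_mem _ ?_
          have := hW (g * γ) ⟨z, hz⟩
          rwa [cosetIsometry_apply, QuotientGroup.mk_mul_of_mem g hγ] at this
        · exact (Submodule.isClosed_topologicalClosure _).preimage A.continuous
      have := hle (Submodule.mem_top (x := star (π.op g : H →L[ℂ] H) x))
      change lp.single 2 (g : G ⧸ Γ) ((π.op g : H →L[ℂ] H) (star (π.op g : H →L[ℂ] H) x)) ∈ W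
        at this
      rwa [π.op_star_op_self] at this
    intro η _
    refine (Submodule.isClosed_topologicalClosure _).mem_of_tendsto
      (lp.hasSum_single (by norm_num) η) (Filter.Eventually.of_forall fun s => ?_)
    exact sum_mem fun y _ => hsingle y (η y)

/-- The identification `ℓ²(G/Γ) ⊗ H ≅ ℓ²(G) ⊗ L` given by a splitting `L`. -/
def IsSplitting.toL2 (hS : IsSplitting π Γ L) :
    lp (fun _ : G ⧸ Γ => H) 2 ≃ₗᵢ[ℂ] L2 G L :=
  hS.isHilbertSum.linearIsometryEquiv

theorem IsSplitting.toL2_symm_single (hS : IsSplitting π Γ L) (g : G) (v : L) :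
    hS.toL2.symm (lp.single 2 g v) = lp.single 2 (g : G ⧸ Γ) ((π.op g : H →L[ℂ] H) v) :=
  hS.isHilbertSum.linearIsometryEquiv_symm_apply_single v

theorem IsSplitting.toL2_single (hS : IsSplitting π Γ L) (g : G) (v : L) :
    hS.toL2 (lp.single 2 (g : G ⧸ Γ) ((π.op g : H →L[ℂ] H) v)) = lp.single 2 g v := by
  rw [← hS.toL2_symm_single, LinearIsometryEquiv.apply_symm_apply]

theorem IsSplitting.toL2_apply (hS : IsSplitting π Γ L) (η : lp (fun _ : G ⧸ Γ => H) 2) (g : G) :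
    hS.toL2 η g = L.orthogonalProjectionOnto (star (π.op g : H →L[ℂ] H) (η (g : G ⧸ Γ))) := by
  refine ext_inner_left ℂ fun v : L => ?_
  refine (lp.inner_single_left (𝕜 := ℂ) (G := fun _ : G => L) g v (hS.toL2 η)).symm.trans ?_
  rw [Submodule.inner_orthogonalProjectionOnto_eq_of_mem_left,
    ContinuousLinearMap.star_eq_adjoint, ContinuousLinearMap.adjoint_inner_right,
    ← hS.toL2_single, LinearIsometryEquiv.inner_map_map]
  exact lp.inner_single_left (𝕜 := ℂ) (G := fun _ : G ⧸ Γ => H) (g : G ⧸ Γ) _ η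

/-- The transport of operators from `ℓ²(G/Γ) ⊗ H` to `ℓ²(G) ⊗ L`. -/
def IsSplitting.conj (hS : IsSplitting π Γ L) :
    (lp (fun _ : G ⧸ Γ => H) 2 →L[ℂ] lp (fun _ : G ⧸ Γ => H) 2) ≃⋆ₐ[ℂ]
      (L2 G L →L[ℂ] L2 G L) :=
  hS.toL2.conjStarAlgEquiv

theorem IsSplitting.conj_apply (hS : IsSplitting π Γ L)
    (T : lp (fun _ : G ⧸ Γ => H) 2 →L[ℂ] lp (fun _ : G ⧸ Γ => H) 2) (ξ : L2 G L) :
    hS.conj T ξ = hS.toL2 (T (hS.toL2.symm ξ)) := rfl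

theorem IsSplitting.conj_add (hS : IsSplitting π Γ L)
    (T T' : lp (fun _ : G ⧸ Γ => H) 2 →L[ℂ] lp (fun _ : G ⧸ Γ => H) 2) :
    hS.conj (T + T') = hS.conj T + hS.conj T' :=
  hS.conj.map_add' T T'

theorem IsSplitting.conj_smul (hS : IsSplitting π Γ L) (a : ℂ)
    (T : lp (fun _ : G ⧸ Γ => H) 2 →L[ℂ] lp (fun _ : G ⧸ Γ => H) 2) :
    hS.conj (a • T) = a • hS.conj T :=
  hS.conj.map_smul' a T

theorem IsSplitting.conj_star (hS : IsSplitting π Γ L)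
    (T : lp (fun _ : G ⧸ Γ => H) 2 →L[ℂ] lp (fun _ : G ⧸ Γ => H) 2) :
    hS.conj (star T) = star (hS.conj T) :=
  hS.conj.map_star' T

theorem IsSplitting.conj_single (hS : IsSplitting π Γ L)
    (T : lp (fun _ : G ⧸ Γ => H) 2 →L[ℂ] lp (fun _ : G ⧸ Γ => H) 2) (k : G) (v : L) (g : G) :
    hS.conj T (lp.single 2 k v) g = L.orthogonalProjectionOnto (star (π.op g : H →L[ℂ] H)
      (T (lp.single 2 (k : G ⧸ Γ) ((π.op k : H →L[ℂ] H) v)) (g : G ⧸ Γ))) := by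
  rw [hS.conj_apply, hS.toL2_apply, hS.toL2_symm_single]

/-- The series of the operator with blocks `T_{gΓ,kΓ} π(k) = f(g⁻¹k) π(k) X`. -/
theorem IsSplitting.isSeries_conj (hS : IsSplitting π Γ L)
    {T : lp (fun _ : G ⧸ Γ => H) 2 →L[ℂ] lp (fun _ : G ⧸ Γ => H) 2} {f : G → ℂ} {X : H →L[ℂ] H}
    (hT : ∀ (k g : G) (x : H), T (lp.single 2 (k : G ⧸ Γ) ((π.op k : H →L[ℂ] H) x)) (g : G ⧸ Γ) =
      f (g⁻¹ * k) • (π.op k : H →L[ℂ] H) (X x)) :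
    IsSeries π.cocycle (fun θ => f θ • compress L ((π.op θ : H →L[ℂ] H) * X)) (hS.conj T) := by
  rw [isSeries_iff]
  intro k v g
  rw [hS.conj_single, hT, map_smul, π.star_op_op, map_smul, map_smul, smul_comm]
  rfl

end Splitting

/-! ### Left translations and the diagonal block at the trivial coset -/

section Blocks

variable {G : Type v} [Group G] {H : Type u} [NormedAddCommGroup H] [InnerProductSpace ℂ H]
  [CompleteSpace H]

theorem exists_leftTranslation (π : ProjUnitaryRep G H) (Γ : Subgroup G) (s : G) :
    ∃ T : lp (fun _ : G ⧸ Γ => H) 2 →L[ℂ] lp (fun _ : G ⧸ Γ => H) 2,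
      ∀ y x, T (lp.single 2 y x) = lp.single 2 (s • y) ((π.op s : H →L[ℂ] H) x) := by
  obtain ⟨T, hT⟩ := exists_matrix_operator (ι := G ⧸ Γ)
    (fun i j => if i = s • j then (π.op s : H →L[ℂ] H) else 0) (C := 1) (n := 1) (m := 1)
    (fun i => {s⁻¹ • i}) (fun j => {s • j})
    (fun i j h => by
      by_contra h'
      exact h (if_neg fun e => h' (by simp [e]))) (fun _ => by simp)
    (fun i j h => by
      by_contra h'
      exact h (if_neg fun e => h' (by simp [e]))) (fun _ => by simp)
    (fun i j => by
      split_ifs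
      · exact π.norm_op_le s
      · simp)
  refine ⟨T, fun j x => ?_⟩
  ext i
  rw [hT]
  by_cases h : i = s • j
  · subst h; simp
  · rw [if_neg h, lp.single_apply_ne _ _ _ h]; rfl

/-- The left translation by `s` on `ℓ²(G/Γ) ⊗ H`: `δ_y ⊗ x ↦ δ_{sy} ⊗ π(s) x`. -/
def leftTranslation (π : ProjUnitaryRep G H) (Γ : Subgroup G) (s : G) :
    lp (fun _ : G ⧸ Γ => H) 2 →L[ℂ] lp (fun _ : G ⧸ Γ => H) 2 :=
  (exists_leftTranslation π Γ s).choose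

theorem leftTranslation_single (π : ProjUnitaryRep G H) (Γ : Subgroup G) (s : G) (y : G ⧸ Γ)
    (x : H) :
    leftTranslation π Γ s (lp.single 2 y x) = lp.single 2 (s • y) ((π.op s : H →L[ℂ] H) x) :=
  (exists_leftTranslation π Γ s).choose_spec y x

theorem leftTranslation_apply_smul (π : ProjUnitaryRep G H) (Γ : Subgroup G) (s : G)
    (η : lp (fun _ : G ⧸ Γ => H) 2) (y : G ⧸ Γ) :
    leftTranslation π Γ s η (s • y) = (π.op s : H →L[ℂ] H) (η y) := by
  have h1 := hasSum_eval (hasSum_apply_single (leftTranslation π Γ s) η) (s • y)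
  simp only [leftTranslation_single] at h1
  have h2 := hasSum_single (f := fun j : G ⧸ Γ => (lp.single 2 (s • j)
    ((π.op s : H →L[ℂ] H) (η j)) : lp (fun _ : G ⧸ Γ => H) 2) (s • y)) y
    (fun j hj => lp.single_apply_ne _ _ _ fun h => hj (smul_left_cancel s h).symm)
  rw [lp.single_apply_self] at h2
  exact h1.unique h2

theorem exists_baseProjection (H : Type u) [NormedAddCommGroup H] [InnerProductSpace ℂ H]
    (Γ : Subgroup G) :
    ∃ Q : lp (fun _ : G ⧸ Γ => H) 2 →L[ℂ] lp (fun _ : G ⧸ Γ => H) 2,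
      ∀ η, Q η = lp.single 2 ((1 : G) : G ⧸ Γ) (η ((1 : G) : G ⧸ Γ)) :=
  ⟨lp.singleContinuousLinearMap ℂ (fun _ : G ⧸ Γ => H) 2 ((1 : G) : G ⧸ Γ) ∘L
    lp.evalCLM ℂ (fun _ : G ⧸ Γ => H) 2 ((1 : G) : G ⧸ Γ), fun _ => rfl⟩

variable {π : ProjUnitaryRep G H} {Γ : Subgroup G} {L : Submodule ℂ H} [CompleteSpace L]

namespace IsSplitting

theorem conj_leftTranslation_single (hS : IsSplitting π Γ L) (s k : G) (v : L) :
    hS.conj (leftTranslation π Γ s) (lp.single 2 k v) =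
      lp.single 2 (s * k) ((π.cocycle s k : ℂ) • v) := by
  rw [hS.conj_apply, hS.toL2_symm_single, leftTranslation_single, π.op_op, lp.single_smul,
    map_smul, lp.single_smul, ← hS.toL2_single (s * k) v]
  rfl

/-- On `ℓ²(G) ⊗ L` these are the twisted left translations, and their commutation with the twisted
right translations is precisely the cocycle identity. -/
theorem commute_leftTranslation (hS : IsSplitting π Γ L) {Λ : Subgroup G}
    {T : L2 G L →L[ℂ] L2 G L} (hT : T ∈ rightAlg π.cocycle L Λ) (s : G) :
    hS.conj (leftTranslation π Γ s) * T = T * hS.conj (leftTranslation π Γ s) := by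
  refine commute_of_mem_rightAlg hT (fun θ _ A => ext_single fun k v => ?_)
    (fun θ _ A => ext_single fun k v => ?_)
  · simp only [mul_apply_eq_comp, conj_leftTranslation_single, rightTensor_single, map_smul,
      mul_assoc, smul_smul, ← Circle.coe_mul]
    congr 3
    change (_ : Circle) = _
    have h := π.cocycle_assoc s (k * θ⁻¹) θ
    rw [inv_mul_cancel_right] at h
    rw [inv_mul_eq_iff_eq_mul, ← mul_assoc, eq_mul_inv_iff_mul_eq, ← h, mul_comm]
  · simp only [mul_apply_eq_comp, conj_leftTranslation_single, star_rightTensor_single, map_smul,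
      mul_assoc, smul_smul, ← Circle.coe_mul]
    rw [mul_comm (π.cocycle (s * k) θ), π.cocycle_assoc, mul_comm]

/-- Transported to `ℓ²(G) ⊗ L`, `Q` is the restriction of functions to `Γ`, a set stable under right
multiplication by `Γ`. -/
theorem commute_baseProjection (hS : IsSplitting π Γ L) {T : L2 G L →L[ℂ] L2 G L}
    (hT : T ∈ rightAlg π.cocycle L Γ)
    {Q : lp (fun _ : G ⧸ Γ => H) 2 →L[ℂ] lp (fun _ : G ⧸ Γ => H) 2}
    (hQ : ∀ η, Q η = lp.single 2 ((1 : G) : G ⧸ Γ) (η ((1 : G) : G ⧸ Γ))) :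
    hS.conj Q * T = T * hS.conj Q := by
  have hsingle : ∀ (k : G) (v : L), hS.conj Q (lp.single 2 k v) =
      if k ∈ Γ then lp.single 2 k v else 0 := by
    intro k v
    rw [hS.conj_apply, hS.toL2_symm_single, hQ]
    split_ifs with hk
    · have : (k : G ⧸ Γ) = ((1 : G) : G ⧸ Γ) := (QuotientGroup.eq.2 (by simpa using hk)).symm
      rw [← this, lp.single_apply_self, hS.toL2_single]
    · rw [lp.single_apply_ne, lp.single_zero, map_zero]
      intro h
      exact hk (by simpa using QuotientGroup.eq.1 h)
  refine commute_of_mem_rightAlg hT (fun θ hθ A => ext_single fun k v => ?_)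
    (fun θ hθ A => ext_single fun k v => ?_)
  · simp only [mul_apply_eq_comp, hsingle, rightTensor_single,
      Subgroup.mul_mem_cancel_right Γ (inv_mem hθ)]
    split_ifs
    · rw [rightTensor_single]
    · exact map_zero _
  · simp only [mul_apply_eq_comp, hsingle, star_rightTensor_single,
      Subgroup.mul_mem_cancel_right Γ hθ]
    split_ifs
    · rw [star_rightTensor_single]
    · exact map_zero _

/-- The isometry of `H` onto the functions supported on `Γ` in `ℓ²(G) ⊗ L`. -/
def base (hS : IsSplitting π Γ L) : H →L[ℂ] L2 G L :=
  (hS.toL2 : lp (fun _ : G ⧸ Γ => H) 2 →L[ℂ] L2 G L) ∘L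
    lp.singleContinuousLinearMap ℂ (fun _ : G ⧸ Γ => H) 2 ((1 : G) : G ⧸ Γ)

theorem base_apply (hS : IsSplitting π Γ L) (x : H) :
    hS.base x = hS.toL2 (lp.single 2 ((1 : G) : G ⧸ Γ) x) := rfl

theorem base_coe (hS : IsSplitting π Γ L) (v : L) : hS.base v = lp.single 2 1 v := by
  rw [base_apply, ← hS.toL2_single, π.op_one_apply]

theorem adjoint_base_apply (hS : IsSplitting π Γ L) (ξ : L2 G L) :
    ContinuousLinearMap.adjoint hS.base ξ = hS.toL2.symm ξ ((1 : G) : G ⧸ Γ) := by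
  refine ext_inner_left ℂ fun x => ?_
  rw [ContinuousLinearMap.adjoint_inner_right, base_apply, LinearIsometryEquiv.inner_map_eq_flip]
  exact lp.inner_single_left (𝕜 := ℂ) (G := fun _ : G ⧸ Γ => H) _ _ _

theorem adjoint_base_base (hS : IsSplitting π Γ L) (x : H) :
    ContinuousLinearMap.adjoint hS.base (hS.base x) = x := by
  rw [adjoint_base_apply, base_apply, LinearIsometryEquiv.symm_apply_apply, lp.single_apply_self]

/-- The diagonal block at the trivial coset of an operator on `ℓ²(G) ⊗ L ≅ ℓ²(G/Γ) ⊗ H`. -/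
def block (hS : IsSplitting π Γ L) : (L2 G L →L[ℂ] L2 G L) →ₗ[ℂ] (H →L[ℂ] H) where
  toFun T := ContinuousLinearMap.adjoint hS.base ∘L T ∘L hS.base
  map_add' T T' := by ext x; simp
  map_smul' a T := by ext x; simp

theorem block_apply (hS : IsSplitting π Γ L) (T : L2 G L →L[ℂ] L2 G L) (x : H) :
    hS.block T x = ContinuousLinearMap.adjoint hS.base (T (hS.base x)) := rfl

theorem block_conj_apply (hS : IsSplitting π Γ L)
    (T : lp (fun _ : G ⧸ Γ => H) 2 →L[ℂ] lp (fun _ : G ⧸ Γ => H) 2) (x : H) :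
    hS.block (hS.conj T) x = T (lp.single 2 ((1 : G) : G ⧸ Γ) x) ((1 : G) : G ⧸ Γ) := by
  rw [block_apply, base_apply, conj_apply, adjoint_base_apply,
    LinearIsometryEquiv.symm_apply_apply, LinearIsometryEquiv.symm_apply_apply]

theorem block_star (hS : IsSplitting π Γ L) (T : L2 G L →L[ℂ] L2 G L) :
    hS.block (star T) = star (hS.block T) := by
  ext x
  refine ext_inner_right ℂ fun y => ?_
  simp only [block_apply, ContinuousLinearMap.star_eq_adjoint,
    ContinuousLinearMap.adjoint_inner_left, ContinuousLinearMap.adjoint_inner_right]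

theorem base_block (hS : IsSplitting π Γ L) {T : L2 G L →L[ℂ] L2 G L}
    (hT : T ∈ rightAlg π.cocycle L Γ) (x : H) : hS.base (hS.block T x) = T (hS.base x) := by
  obtain ⟨Q, hQ⟩ := exists_baseProjection (G := G) H Γ
  have hc := congrArg (fun W => W (hS.base x)) (hS.commute_baseProjection hT hQ)
  simp only [mul_apply_eq_comp] at hc
  have h1 : ∀ ξ, hS.conj Q ξ = hS.base (ContinuousLinearMap.adjoint hS.base ξ) := by
    intro ξ
    rw [conj_apply, hQ, adjoint_base_apply, base_apply]
  rw [h1, h1, adjoint_base_base] at hc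
  exact hc

/-- Compression to a fibre is multiplicative once the right factor maps that fibre into itself
(`base_block`). -/
theorem block_mul_of_mem_right (hS : IsSplitting π Γ L) (T : L2 G L →L[ℂ] L2 G L)
    {T' : L2 G L →L[ℂ] L2 G L} (hT' : T' ∈ rightAlg π.cocycle L Γ) :
    hS.block (T * T') = hS.block T * hS.block T' := by
  ext x
  rw [mul_apply_eq_comp, block_apply, block_apply _ T, hS.base_block hT', mul_apply_eq_comp]

theorem block_mul_of_mem_left (hS : IsSplitting π Γ L) {T : L2 G L →L[ℂ] L2 G L}
    (T' : L2 G L →L[ℂ] L2 G L) (hT : T ∈ rightAlg π.cocycle L Γ) :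
    hS.block (T * T') = hS.block T * hS.block T' := by
  have h := hS.block_mul_of_mem_right (star T') (T' := star T) (star_mem hT)
  have h' : star T' * star T = star (T * T') := (star_mul T T').symm
  rw [h', block_star, block_star, block_star, ← star_mul] at h
  exact star_injective h

/-- `δ_e ⊗ L` is separating: left translations commute with `T` and carry `δ_e ⊗ v` to every `δ_k ⊗
v`. -/
theorem eq_zero_of_mem_rightAlg (hS : IsSplitting π Γ L) {Λ : Subgroup G}
    {T : L2 G L →L[ℂ] L2 G L} (hT : T ∈ rightAlg π.cocycle L Λ)
    (h : ∀ v : L, T (lp.single 2 1 v) = 0) : T = 0 := by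
  refine ext_single fun k v => ?_
  have h1 := hS.conj_leftTranslation_single k 1 v
  rw [π.cocycle_one_right, mul_one, Circle.coe_one, one_smul] at h1
  rw [← h1, ← mul_apply_eq_comp, ← hS.commute_leftTranslation hT, mul_apply_eq_comp, h, map_zero]
  rfl

theorem block_injOn (hS : IsSplitting π Γ L) :
    Set.InjOn hS.block (rightAlg π.cocycle L Γ : Set (L2 G L →L[ℂ] L2 G L)) := by
  intro T hT T' hT' h
  rw [← sub_eq_zero]
  refine hS.eq_zero_of_mem_rightAlg (sub_mem hT hT') fun v => ?_
  rw [← hS.base_coe, ← hS.base_block (sub_mem hT hT'), map_sub, sub_eq_zero.2 h]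
  simp

/-- Left translation by `γ ∈ Γ` fixes the trivial coset and acts on its fibre as `π(γ)`. Thus even
the blocks of elements of `R(G) ⊗ B(L)` lie in `π(Γ)'`, which makes the conditional expectation
definable. -/
theorem block_op_comm (hS : IsSplitting π Γ L) {Λ : Subgroup G} {T : L2 G L →L[ℂ] L2 G L}
    (hT : T ∈ rightAlg π.cocycle L Λ) {γ : G} (hγ : γ ∈ Γ) :
    (π.op γ : H →L[ℂ] H) * hS.block T = hS.block T * (π.op γ : H →L[ℂ] H) := by
  have hq : γ • ((1 : G) : G ⧸ Γ) = ((1 : G) : G ⧸ Γ) :=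
    (QuotientGroup.eq.2 (by simpa using hγ)).symm
  ext x
  have hc := congrArg (fun W => W (hS.base x)) (hS.commute_leftTranslation hT γ)
  simp only [mul_apply_eq_comp] at hc
  have h1 : hS.conj (leftTranslation π Γ γ) (hS.base x) = hS.base ((π.op γ : H →L[ℂ] H) x) := by
    rw [base_apply, conj_apply, LinearIsometryEquiv.symm_apply_apply, leftTranslation_single, hq,
      base_apply]
  have h2 : ∀ ξ, ContinuousLinearMap.adjoint hS.base (hS.conj (leftTranslation π Γ γ) ξ) =
      (π.op γ : H →L[ℂ] H) (ContinuousLinearMap.adjoint hS.base ξ) := by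
    intro ξ
    rw [adjoint_base_apply, conj_apply, LinearIsometryEquiv.symm_apply_apply, adjoint_base_apply,
      ← leftTranslation_apply_smul, hq]
  rw [mul_apply_eq_comp, mul_apply_eq_comp, block_apply, block_apply, ← h1, ← hc, h2]

theorem hasTrace_iff (hS : IsSplitting π Γ L) (T : L2 G L →L[ℂ] L2 G L) (t : ℂ) :
    HasTrace T t ↔ ∀ (ι : Type u) (b : HilbertBasis ι ℂ L),
      HasSum (fun i => inner ℂ (b i : H) (hS.block T (b i))) t := by
  refine forall_congr' fun ι => forall_congr' fun b => ?_
  refine iff_of_eq (congrArg (fun f => HasSum f t) (funext fun i => ?_))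
  rw [block_apply, ContinuousLinearMap.adjoint_inner_right, base_coe]

end IsSplitting

end Blocks

/-! ### Double cosets and bi-invariant functions -/

section HeckeFunctions

variable {G : Type v} [Group G] {Γ : Subgroup G}

/-- A bi-`Γ`-invariant function on `G` supported on finitely many left cosets of `Γ`. -/
structure IsHeckeFun (Γ : Subgroup G) (f : G → ℂ) : Prop where
  left_inv : ∀ γ ∈ Γ, ∀ x, f (γ * x) = f x
  right_inv : ∀ γ ∈ Γ, ∀ x, f (x * γ) = f x
  finite : {y : G ⧸ Γ | f y.out ≠ 0}.Finite

theorem mem_dcoset {σ x : G} : x ∈ dcoset Γ σ ↔ ∃ a ∈ Γ, ∃ b ∈ Γ, x = a * σ * b :=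
  DoubleCoset.mem_doubleCoset

theorem mul_mem_dcoset_left {σ γ x : G} (hγ : γ ∈ Γ) : γ * x ∈ dcoset Γ σ ↔ x ∈ dcoset Γ σ := by
  rw [mem_dcoset, mem_dcoset]
  constructor
  · rintro ⟨a, ha, b, hb, h⟩
    exact ⟨γ⁻¹ * a, mul_mem (inv_mem hγ) ha, b, hb, by
      rw [mul_assoc, mul_assoc, ← mul_assoc a, ← h, inv_mul_cancel_left]⟩
  · rintro ⟨a, ha, b, hb, rfl⟩
    exact ⟨γ * a, mul_mem hγ ha, b, hb, by simp only [mul_assoc]⟩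

theorem mul_mem_dcoset_right {σ γ x : G} (hγ : γ ∈ Γ) : x * γ ∈ dcoset Γ σ ↔ x ∈ dcoset Γ σ := by
  rw [mem_dcoset, mem_dcoset]
  constructor
  · rintro ⟨a, ha, b, hb, h⟩
    exact ⟨a, ha, b * γ⁻¹, mul_mem hb (inv_mem hγ), by
      rw [← mul_assoc, ← h, mul_inv_cancel_right]⟩
  · rintro ⟨a, ha, b, hb, rfl⟩
    exact ⟨a, ha, b * γ, mul_mem hb hγ, by simp only [mul_assoc]⟩

theorem inv_mem_dcoset {σ x : G} : x⁻¹ ∈ dcoset Γ σ ↔ x ∈ dcoset Γ σ⁻¹ := by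
  rw [mem_dcoset, mem_dcoset]
  constructor
  · rintro ⟨a, ha, b, hb, h⟩
    refine ⟨b⁻¹, inv_mem hb, a⁻¹, inv_mem ha, ?_⟩
    rw [← inv_inv x, h]; group
  · rintro ⟨a, ha, b, hb, rfl⟩
    exact ⟨b⁻¹, inv_mem hb, a⁻¹, inv_mem ha, by group⟩

theorem dcoset_eq_of_mem {σ τ : G} (h : τ ∈ dcoset Γ σ) : dcoset Γ τ = dcoset Γ σ :=
  DoubleCoset.doubleCoset_eq_of_mem h

theorem mem_dcoset_one {x : G} : x ∈ dcoset Γ 1 ↔ x ∈ Γ := by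
  rw [mem_dcoset]
  constructor
  · rintro ⟨a, ha, b, hb, rfl⟩
    simpa using mul_mem ha hb
  · exact fun h => ⟨x, h, 1, one_mem _, by simp⟩

/-- A double coset of an almost normal subgroup consists of finitely many left cosets. -/
theorem IsAlmostNormal.finite_dcoset (hΓ : IsAlmostNormal Γ) (σ : G) :
    {y : G ⧸ Γ | y.out ∈ dcoset Γ σ}.Finite := by
  let N : Subgroup Γ := (MulAut.conj σ • Γ).subgroupOf Γ
  have : Finite (Γ ⧸ N) := 
    have : N.FiniteIndex := ⟨hΓ σ⟩
    Subgroup.finite_quotient_of_finiteIndex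
  refine (Set.finite_range fun q : Γ ⧸ N => (((q.out : Γ) * σ : G) : G ⧸ Γ)).subset ?_
  intro y hy
  obtain ⟨a, ha, b, hb, h⟩ := mem_dcoset.1 hy
  refine ⟨((⟨a, ha⟩ : Γ) : Γ ⧸ N), ?_⟩
  obtain ⟨⟨n, hn⟩, hout⟩ := QuotientGroup.mk_out_eq_mul N ⟨a, ha⟩
  rw [← QuotientGroup.out_eq' y, h, QuotientGroup.mk_mul_of_mem _ hb]
  simp only [hout]
  have hn' : (n : G) ∈ MulAut.conj σ • Γ := hn
  rw [Subgroup.mem_pointwise_smul_iff_inv_smul_mem] at hn'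
  refine QuotientGroup.eq.2 ?_
  -- The chosen representative is `a n` with `n ∈ σΓσ⁻¹`, and `σ⁻¹nσ ∈ Γ` does not change the coset
  -- `aσΓ`.
  have h2 : (a * (n : G) * σ)⁻¹ * (a * σ) = ((MulAut.conj σ)⁻¹ • (n : G))⁻¹ := by
    simp only [MulAut.smul_def, MulAut.conj_inv_apply]
    group
  change (a * (n : G) * σ)⁻¹ * (a * σ) ∈ Γ
  rw [h2]
  exact inv_mem hn'

theorem dcosetFun_apply (σ x : G) : dcosetFun Γ σ x = if x ∈ dcoset Γ σ then 1 else 0 := by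
  simp [dcosetFun, Set.indicator_apply]

theorem isHeckeFun_dcosetFun (hΓ : IsAlmostNormal Γ) (σ : G) : IsHeckeFun Γ (dcosetFun Γ σ) where
  left_inv γ hγ x := by simp only [dcosetFun_apply, mul_mem_dcoset_left hγ]
  right_inv γ hγ x := by simp only [dcosetFun_apply, mul_mem_dcoset_right hγ]
  finite := by simpa [dcosetFun_apply] using hΓ.finite_dcoset σ

theorem dcosetFun_mem (σ : G) : dcosetFun Γ σ ∈ heckeSpace Γ :=
  Submodule.subset_span ⟨σ, rfl⟩

theorem isHeckeFun_of_mem (hΓ : IsAlmostNormal Γ) {f : G → ℂ} (hf : f ∈ heckeSpace Γ) :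
    IsHeckeFun Γ f := by
  induction hf using Submodule.span_induction with
  | mem f hf =>
    obtain ⟨σ, rfl⟩ := hf
    exact isHeckeFun_dcosetFun hΓ σ
  | zero => exact ⟨fun _ _ _ => rfl, fun _ _ _ => rfl, by simp⟩
  | add f h _ _ hf hh =>
    refine ⟨fun γ hγ x => ?_, fun γ hγ x => ?_, (hf.finite.union hh.finite).subset fun y hy => ?_⟩
    · simp [hf.left_inv γ hγ, hh.left_inv γ hγ]
    · simp [hf.right_inv γ hγ, hh.right_inv γ hγ]
    · by_contra h'
      simp only [Set.mem_union, Set.mem_ofPred_eq, not_or, not_not] at h'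
      exact hy (by simp [h'.1, h'.2])
  | smul a f _ hf =>
    refine ⟨fun γ hγ x => ?_, fun γ hγ x => ?_, hf.finite.subset fun y hy h => hy ?_⟩
    · simp [hf.left_inv γ hγ]
    · simp [hf.right_inv γ hγ]
    · simp [h]

theorem exists_out_smul_eq (g : G) (y : G ⧸ Γ) : ∃ γ ∈ Γ, (g • y).out = g * y.out * γ := by
  have h := QuotientGroup.mk_out_eq_mul Γ (g * y.out)
  obtain ⟨⟨γ, hγ⟩, h⟩ := h
  refine ⟨γ, hγ, ?_⟩
  rw [← h]
  congr 1
  conv_lhs => rw [← QuotientGroup.out_eq' y]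
  rfl

theorem IsHeckeFun.apply_out {f : G → ℂ} (hf : IsHeckeFun Γ f) (g : G) (y : G ⧸ Γ) :
    f (g⁻¹ * (g • y).out) = f y.out := by
  obtain ⟨γ, hγ, h⟩ := exists_out_smul_eq g y
  rw [h, mul_assoc, inv_mul_cancel_left, hf.right_inv γ hγ]

theorem IsHeckeFun.apply_out_inv {f : G → ℂ} (hf : IsHeckeFun Γ f) (g k : G) (y : G ⧸ Γ) :
    f ((g • y).out⁻¹ * k) = f (y.out⁻¹ * (g⁻¹ * k)) := by
  obtain ⟨γ, hγ, h⟩ := exists_out_smul_eq g y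
  rw [h, mul_inv_rev, mul_inv_rev, mul_assoc, hf.left_inv _ (inv_mem hγ), mul_assoc]

end HeckeFunctions

/-! ### The Hecke algebra acting on `ℓ²(G/Γ) ⊗ H` -/

section HeckeOperators

variable {G : Type v} [Group G] {Γ : Subgroup G} {H : Type u} [NormedAddCommGroup H]
  [InnerProductSpace ℂ H]

/-- `T` is the operator on `ℓ²(G/Γ) ⊗ H` with matrix `(f(g⁻¹k))_{gΓ, kΓ}`. -/
def ActsBy (T : lp (fun _ : G ⧸ Γ => H) 2 →L[ℂ] lp (fun _ : G ⧸ Γ => H) 2) (f : G → ℂ) : Prop :=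
  ∀ (k g : G) (x : H), T (lp.single 2 (k : G ⧸ Γ) x) (g : G ⧸ Γ) = f (g⁻¹ * k) • x

/-- The nonzero entries of a row lie in a translate of `ΓσΓ/Γ`, those of a column in a translate of
`Γσ⁻¹Γ/Γ`. Almost normality makes both finite, with bounds independent of the row or column. -/
theorem exists_actsBy_dcosetFun (hΓ : IsAlmostNormal Γ) (σ : G) :
    ∃ T : lp (fun _ : G ⧸ Γ => H) 2 →L[ℂ] lp (fun _ : G ⧸ Γ => H) 2,
      ActsBy T (dcosetFun Γ σ) := by
  have hf := isHeckeFun_dcosetFun hΓ σ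
  have hinv : ∀ g k : G, dcosetFun Γ σ (g⁻¹ * k) = dcosetFun Γ σ⁻¹ (k⁻¹ * g) := by
    intro g k
    rw [dcosetFun_apply, dcosetFun_apply, ← inv_mem_dcoset, mul_inv_rev, inv_inv]
  have hfin : ∀ τ : G, ∀ i j : G ⧸ Γ, dcosetFun Γ τ (i.out⁻¹ * j.out) ≠ 0 →
      j ∈ (hΓ.finite_dcoset τ).toFinset.image (fun y => i.out • y) := by
    intro τ i j h
    refine Finset.mem_image.2 ⟨i.out⁻¹ • j, ?_, smul_inv_smul _ _⟩
    rw [Set.Finite.mem_toFinset, Set.mem_ofPred_eq]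
    have := (isHeckeFun_dcosetFun hΓ τ).apply_out i.out (i.out⁻¹ • j)
    rw [smul_inv_smul] at this
    rw [this, dcosetFun_apply] at h
    by_contra h'
    exact h (if_neg h')
  obtain ⟨T, hT⟩ := exists_matrix_operator (ι := G ⧸ Γ)
    (fun i j => dcosetFun Γ σ (i.out⁻¹ * j.out) • (1 : H →L[ℂ] H)) (C := 1)
    (fun i => (hΓ.finite_dcoset σ).toFinset.image (fun y => i.out • y))
    (fun j => (hΓ.finite_dcoset σ⁻¹).toFinset.image (fun y => j.out • y))
    (fun i j h => hfin σ i j fun h' => h (by rw [h', zero_smul]))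
    (fun _ => Finset.card_image_le)
    (fun i j h => hfin σ⁻¹ j i fun h' => h (by rw [hinv, h', zero_smul]))
    (fun _ => Finset.card_image_le)
    (fun i j => by
      rw [norm_smul, dcosetFun_apply]
      split_ifs
      · rw [norm_one, one_mul]; exact ContinuousLinearMap.norm_id_le
      · simp)
  refine ⟨T, fun k g x => ?_⟩
  rw [hT]
  obtain ⟨⟨a, ha⟩, h1⟩ := QuotientGroup.mk_out_eq_mul Γ g
  obtain ⟨⟨b, hb⟩, h2⟩ := QuotientGroup.mk_out_eq_mul Γ k
  have : ((g : G ⧸ Γ).out)⁻¹ * (k : G ⧸ Γ).out = a⁻¹ * (g⁻¹ * k * b) := by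
    rw [h1, h2]; group
  rw [this, hf.left_inv _ (inv_mem ha), hf.right_inv _ hb]
  rfl

theorem exists_actsBy (hΓ : IsAlmostNormal Γ) {f : G → ℂ} (hf : f ∈ heckeSpace Γ) :
    ∃ T : lp (fun _ : G ⧸ Γ => H) 2 →L[ℂ] lp (fun _ : G ⧸ Γ => H) 2, ActsBy T f := by
  induction hf using Submodule.span_induction with
  | mem f hf =>
    obtain ⟨σ, rfl⟩ := hf
    exact exists_actsBy_dcosetFun hΓ σ
  | zero => exact ⟨0, fun k g x => by simp⟩
  | add f h _ _ hf hh =>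
    obtain ⟨T, hT⟩ := hf
    obtain ⟨T', hT'⟩ := hh
    exact ⟨T + T', fun k g x => by simp [hT k g x, hT' k g x, add_smul]⟩
  | smul a f _ hf =>
    obtain ⟨T, hT⟩ := hf
    exact ⟨a • T, fun k g x => by simp [hT k g x, mul_smul]⟩

theorem ActsBy.one : ActsBy (1 : lp (fun _ : G ⧸ Γ => H) 2 →L[ℂ] lp (fun _ : G ⧸ Γ => H) 2)
    (dcosetFun Γ 1) := by
  intro k g x
  rw [dcosetFun_apply, mem_dcoset_one, one_apply_eq_self]
  split_ifs with h
  · rw [QuotientGroup.eq.2 h, lp.single_apply_self, one_smul]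
  · rw [lp.single_apply_ne _ _ _ fun e => h (QuotientGroup.eq.1 e), zero_smul]

theorem ActsBy.hasSum_mul {T T' : lp (fun _ : G ⧸ Γ => H) 2 →L[ℂ] lp (fun _ : G ⧸ Γ => H) 2}
    {f : G → ℂ} (hT : ActsBy T f) (k g : G) (x : H) :
    HasSum (fun w : G ⧸ Γ => f (g⁻¹ * w.out) • T' (lp.single 2 (k : G ⧸ Γ) x) w)
      ((T * T') (lp.single 2 (k : G ⧸ Γ) x) (g : G ⧸ Γ)) := by
  have h := hasSum_eval (hasSum_apply_single T (T' (lp.single 2 (k : G ⧸ Γ) x))) (g : G ⧸ Γ)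
  convert! h using 2 with w
  rw [← hT w.out g, QuotientGroup.out_eq']

/-- Summing over the intermediate coset `w = g y`, bi-invariance turns the matrix product into the
convolution at `g⁻¹k`, whatever representatives are chosen. -/
theorem ActsBy.mul {T T' : lp (fun _ : G ⧸ Γ => H) 2 →L[ℂ] lp (fun _ : G ⧸ Γ => H) 2}
    {f h : G → ℂ} (hT : ActsBy T f) (hT' : ActsBy T' h) (hf : IsHeckeFun Γ f)
    (hh : IsHeckeFun Γ h) : ActsBy (T * T') (heckeMul Γ f h) := by
  intro k g x
  have h1 := hT.hasSum_mul (T' := T') k g x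
  rw [← (MulAction.toPerm g).hasSum_iff] at h1
  have h2 : ∀ y : G ⧸ Γ, ((fun w : G ⧸ Γ => f (g⁻¹ * w.out) •
      T' (lp.single 2 (k : G ⧸ Γ) x) w) ∘ MulAction.toPerm g) y =
      (f y.out * h (y.out⁻¹ * (g⁻¹ * k))) • x := by
    intro y
    have h3 := hT' k (g • y).out x
    rw [QuotientGroup.out_eq'] at h3
    simp only [Function.comp_apply, MulAction.toPerm_apply]
    rw [h3, hf.apply_out, hh.apply_out_inv, smul_smul]
  rw [funext h2] at h1
  have hfin : (Function.support fun y : G ⧸ Γ => f y.out * h (y.out⁻¹ * (g⁻¹ * k))).Finite :=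
    hf.finite.subset fun y hy h0 => hy (by simp [h0])
  have h4 : HasSum (fun y : G ⧸ Γ => f y.out * h (y.out⁻¹ * (g⁻¹ * k)))
      (heckeMul Γ f h (g⁻¹ * k)) := by
    rw [heckeMul, finsum_eq_sum_of_support_subset _ (s := hfin.toFinset) (by simp)]
    exact hasSum_sum_of_ne_finset_zero fun y hy => by
      by_contra h'
      exact hy (hfin.mem_toFinset.2 h')
  exact h1.unique (h4.smul_const x)

theorem ActsBy.star [CompleteSpace H]
    {T : lp (fun _ : G ⧸ Γ => H) 2 →L[ℂ] lp (fun _ : G ⧸ Γ => H) 2}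
    {f : G → ℂ} (hT : ActsBy T f) : ActsBy (star T) (heckeStar f) := by
  intro k g x
  refine ext_inner_right ℂ fun y : H => ?_
  rw [inner_star_single, hT, inner_smul_left, inner_smul_right, heckeStar, mul_inv_rev, inv_inv]
  simp

end HeckeOperators

/-! ### Hilbert–Schmidt sums -/

section HilbertSchmidt

variable {E F : Type*} [NormedAddCommGroup E] [InnerProductSpace ℂ E]
  [NormedAddCommGroup F] [InnerProductSpace ℂ F]

theorem hasSum_norm_inner_sq {ι : Type*} (b : HilbertBasis ι ℂ E) (x : E) :
    HasSum (fun i => ‖(inner ℂ (b i) x : ℂ)‖ ^ 2) (‖x‖ ^ 2) := by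
  have h := b.hasSum_inner_mul_inner x x
  have h2 := Complex.hasSum_re h
  convert! h2 using 1
  · funext i
    rw [← inner_conj_symm x (b i), ← Complex.normSq_eq_conj_mul_self, Complex.ofReal_re,
      Complex.normSq_eq_norm_sq]
  · rw [inner_self_eq_norm_sq_to_K]
    norm_cast

theorem summable_prod_inner {ι κ : Type*} (b : ι → E) (e : HilbertBasis κ ℂ F) (A : E →L[ℂ] F)
    (hA : Summable fun i => ‖A (b i)‖ ^ 2) :
    Summable fun q : ι × κ => ‖(inner ℂ (e q.2) (A (b q.1)) : ℂ)‖ ^ 2 := by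
  refine (summable_prod_of_nonneg fun q => by positivity).2 ⟨fun i => ?_, ?_⟩
  · exact (hasSum_norm_inner_sq e (A (b i))).summable
  · simpa only [(hasSum_norm_inner_sq e _).tsum_eq] using hA

variable [CompleteSpace E] [CompleteSpace F]

/-- Both sums are iterated forms of the nonnegative double sum of `|⟨e_k, A b_i⟩|²`. As `e` is
arbitrary, two applications also change the basis. -/
theorem summable_adjoint {ι κ : Type*} (b : HilbertBasis ι ℂ E) (e : HilbertBasis κ ℂ F)
    (A : E →L[ℂ] F) (hA : Summable fun i => ‖A (b i)‖ ^ 2) :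
    Summable fun k => ‖ContinuousLinearMap.adjoint A (e k)‖ ^ 2 := by
  have h := (summable_prod_inner b e A hA).prod_symm.prod
  convert! h using 2 with k
  rw [← (hasSum_norm_inner_sq b _).tsum_eq]
  refine tsum_congr fun i => ?_
  rw [ContinuousLinearMap.adjoint_inner_right, ← norm_inner_symm]
  rfl

/-- The double series of `⟨C b_i, e_k⟩⟨e_k, A b_i⟩` converges absolutely, so it may be summed in
either order. The value is written through `e` alone, hence does not depend on `b`. -/
theorem hasSum_inner_of_summable {ι κ : Type*} (b : HilbertBasis ι ℂ E) (e : HilbertBasis κ ℂ F)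
    {A C : E →L[ℂ] F} (hA : Summable fun i => ‖A (b i)‖ ^ 2)
    (hC : Summable fun i => ‖C (b i)‖ ^ 2) :
    HasSum (fun i => inner ℂ (C (b i)) (A (b i)))
      (∑' k, inner ℂ (ContinuousLinearMap.adjoint A (e k))
        (ContinuousLinearMap.adjoint C (e k)) : ℂ) := by
  let f : ι × κ → ℂ := fun q => inner ℂ (C (b q.1)) (e q.2) * inner ℂ (e q.2) (A (b q.1))
  have hf : Summable f := by
    refine Summable.of_norm_bounded
      ((summable_prod_inner b e C hC).add (summable_prod_inner b e A hA)) fun q => ?_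
    rw [norm_mul, norm_inner_symm]
    nlinarith [sq_nonneg (‖(inner ℂ (e q.2) (C (b q.1)) : ℂ)‖ -
      ‖(inner ℂ (e q.2) (A (b q.1)) : ℂ)‖), sq_nonneg ‖(inner ℂ (e q.2) (C (b q.1)) : ℂ)‖,
      sq_nonneg ‖(inner ℂ (e q.2) (A (b q.1)) : ℂ)‖]
  have h1 := hf.hasSum.prod_fiberwise fun i => e.hasSum_inner_mul_inner (C (b i)) (A (b i))
  have h2 := hf.prod_symm.hasSum.prod_fiberwise (g := fun k =>
    inner ℂ (ContinuousLinearMap.adjoint A (e k)) (ContinuousLinearMap.adjoint C (e k))) fun k => by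
      convert! b.hasSum_inner_mul_inner (ContinuousLinearMap.adjoint A (e k))
        (ContinuousLinearMap.adjoint C (e k)) using 2 with i
      rw [ContinuousLinearMap.adjoint_inner_left, ContinuousLinearMap.adjoint_inner_right, mul_comm]
      rfl
  have h3 : ∑' q : κ × ι, f q.swap = ∑' q, f q := (Equiv.prodComm κ ι).tsum_eq f
  rw [h2.tsum_eq, h3]
  exact h1

end HilbertSchmidt

/-! ### Finiteness of the trace from `pP_L` -/

section TraceClass

variable {H : Type u} [NormedAddCommGroup H] [InnerProductSpace ℂ H] [CompleteSpace H]

theorem norm_sq_le_of_nonneg {P : H →L[ℂ] H} (hP : 0 ≤ P) :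
    ∃ C : ℝ, ∀ x, ‖P x‖ ^ 2 ≤ C * (inner ℂ x (P x) : ℂ).re := by
  have hQ : IsSelfAdjoint (CFC.sqrt P) := IsSelfAdjoint.of_nonneg (CFC.sqrt_nonneg P)
  have hQP : CFC.sqrt P * CFC.sqrt P = P := CFC.sqrt_mul_sqrt_self P hP
  have hx : ∀ x, P x = CFC.sqrt P (CFC.sqrt P x) := fun x => by
    conv_lhs => rw [← hQP]
    rfl
  refine ⟨‖CFC.sqrt P‖ ^ 2, fun x => ?_⟩
  have h2 : (inner ℂ x (P x) : ℂ).re = ‖CFC.sqrt P x‖ ^ 2 := by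
    rw [hx, ← ContinuousLinearMap.adjoint_inner_left, ← ContinuousLinearMap.star_eq_adjoint,
      hQ.star_eq, inner_self_eq_norm_sq_to_K]
    norm_cast
  rw [h2, hx, ← mul_pow]
  gcongr
  exact (CFC.sqrt P).le_opNorm _

/-- Trace class implies Hilbert–Schmidt: `‖T x‖ = ‖|T| x‖`, and `‖|T| x‖²` is at most a constant
times `⟨x, |T| x⟩`. -/
theorem IsTraceClass.summable_norm_sq {T : H →L[ℂ] H} (hT : IsTraceClass T) :
    ∃ (κ : Type u) (e : HilbertBasis κ ℂ H), Summable fun k => ‖T (e k)‖ ^ 2 := by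
  obtain ⟨κ, e, h⟩ := hT
  refine ⟨κ, e, ?_⟩
  obtain ⟨C, hC⟩ := norm_sq_le_of_nonneg (CFC.abs_nonneg T)
  refine Summable.of_nonneg_of_le (fun _ => by positivity) (fun k => ?_) (h.mul_left C)
  refine le_trans (le_of_eq ?_) (hC (e k))
  have hs : IsSelfAdjoint (CFC.abs T) := IsSelfAdjoint.of_nonneg (CFC.abs_nonneg T)
  have h1 : ∀ S : H →L[ℂ] H, ‖S (e k)‖ ^ 2 = (inner ℂ (e k) ((star S * S) (e k)) : ℂ).re := by
    intro S
    rw [mul_apply_eq_comp, ContinuousLinearMap.star_eq_adjoint,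
      ContinuousLinearMap.adjoint_inner_right, inner_self_eq_norm_sq_to_K]
    norm_cast
  rw [h1, h1, hs.star_eq, CFC.abs_mul_abs]

/-- If `pP_L` is trace class, the trace of `P_L p Y p P_L` exists. -/
theorem exists_hasSum_compression (L H₀ : Submodule ℂ H) [CompleteSpace L] [CompleteSpace H₀]
    (htr : IsTraceClass (H₀.starProjection ∘L L.starProjection)) (Y : H →L[ℂ] H) :
    ∃ t : ℂ, ∀ (ι : Type u) (b : HilbertBasis ι ℂ L),
      HasSum (fun i => inner ℂ (b i : H)
        ((H₀.starProjection * Y * H₀.starProjection) (b i))) t := by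
  obtain ⟨κ, e, he⟩ := htr.summable_norm_sq
  -- With `A = p|_L` and `C = Y* A`, the diagonal terms are `⟨C b_i, A b_i⟩`, so the trace is a
  -- pairing of two Hilbert–Schmidt operators.
  let A : L →L[ℂ] H := H₀.starProjection ∘L L.subtypeL
  let C : L →L[ℂ] H := ContinuousLinearMap.adjoint Y ∘L A
  have hD := summable_adjoint e e _ he
  have hAe : ∀ k, ‖ContinuousLinearMap.adjoint A (e k)‖ ^ 2 =
      ‖ContinuousLinearMap.adjoint (H₀.starProjection ∘L L.starProjection) (e k)‖ ^ 2 := by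
    intro k
    have : ContinuousLinearMap.adjoint (H₀.starProjection ∘L L.starProjection) (e k) =
        ((ContinuousLinearMap.adjoint A (e k) : L) : H) := by
      simp only [A, ContinuousLinearMap.adjoint_comp, ContinuousLinearMap.comp_apply]
      rw [Submodule.adjoint_subtypeL, ← ContinuousLinearMap.star_eq_adjoint L.starProjection,
        (isSelfAdjoint_starProjection L).star_eq]
      rfl
    rw [this]
    rfl
  -- Passing to adjoints moves from the given basis of `H` to an arbitrary basis of `L`; `A*` and
  -- `(pP_L)*` have the same norms on vectors of `H`.
  have hA : ∀ (ι : Type u) (b : HilbertBasis ι ℂ L), Summable fun i => ‖A (b i)‖ ^ 2 := by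
    intro ι b
    have := summable_adjoint e b (ContinuousLinearMap.adjoint A) (by simpa only [hAe] using hD)
    rwa [ContinuousLinearMap.adjoint_adjoint] at this
  refine ⟨∑' k, inner ℂ (ContinuousLinearMap.adjoint A (e k))
    (ContinuousLinearMap.adjoint C (e k)), fun ι b => ?_⟩
  have hC : Summable fun i => ‖C (b i)‖ ^ 2 := by
    refine Summable.of_nonneg_of_le (fun _ => by positivity) (fun i => ?_)
      ((hA ι b).mul_left (‖ContinuousLinearMap.adjoint Y‖ ^ 2))
    rw [← mul_pow]
    gcongr
    exact (ContinuousLinearMap.adjoint Y).le_opNorm _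
  convert! hasSum_inner_of_summable b e (hA ι b) hC using 2 with i
  simp only [C, A, ContinuousLinearMap.comp_apply, mul_apply_eq_comp,
    ContinuousLinearMap.adjoint_inner_left]
  rw [← ContinuousLinearMap.adjoint_inner_left, ← ContinuousLinearMap.star_eq_adjoint,
    (isSelfAdjoint_starProjection H₀).star_eq]
  rfl

end TraceClass

/-! ### Extension by zero from `H₀` to `H` -/

section ExtendZero

variable {H : Type u} [NormedAddCommGroup H] [InnerProductSpace ℂ H]

variable (H₀ : Submodule ℂ H) [CompleteSpace H₀]

/-- The extension by zero of an operator on `H₀`. -/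
def extendZero (X : H₀ →L[ℂ] H₀) : H →L[ℂ] H :=
  H₀.subtypeL ∘L X ∘L H₀.orthogonalProjectionOnto

theorem extendZero_apply (X : H₀ →L[ℂ] H₀) (x : H) :
    extendZero H₀ X x = (X (H₀.orthogonalProjectionOnto x) : H) := rfl

theorem compress_apply (Y : H →L[ℂ] H) (x : H₀) :
    compress H₀ Y x = H₀.orthogonalProjectionOnto (Y x) := rfl

theorem compress_extendZero (X : H₀ →L[ℂ] H₀) : compress H₀ (extendZero H₀ X) = X := by
  ext x
  rw [compress_apply, extendZero_apply, Submodule.orthogonalProjectionOnto_mem_subspace_eq_self,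
    Submodule.orthogonalProjectionOnto_mem_subspace_eq_self]

theorem extendZero_compress (Y : H →L[ℂ] H) :
    extendZero H₀ (compress H₀ Y) = H₀.starProjection * Y * H₀.starProjection := rfl

theorem extendZero_one : extendZero H₀ 1 = H₀.starProjection := rfl

theorem extendZero_add (X Y : H₀ →L[ℂ] H₀) :
    extendZero H₀ (X + Y) = extendZero H₀ X + extendZero H₀ Y := by
  ext x; simp [extendZero_apply]

theorem extendZero_smul (a : ℂ) (X : H₀ →L[ℂ] H₀) :
    extendZero H₀ (a • X) = a • extendZero H₀ X := by
  ext x; simp [extendZero_apply]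

theorem extendZero_mul (X Y : H₀ →L[ℂ] H₀) :
    extendZero H₀ (X * Y) = extendZero H₀ X * extendZero H₀ Y := by
  ext x
  rw [mul_apply_eq_comp, extendZero_apply, extendZero_apply, extendZero_apply,
    Submodule.orthogonalProjectionOnto_mem_subspace_eq_self, mul_apply_eq_comp]

theorem extendZero_star [CompleteSpace H] (X : H₀ →L[ℂ] H₀) :
    extendZero H₀ (star X) = star (extendZero H₀ X) := by
  simp only [extendZero, ContinuousLinearMap.star_eq_adjoint, ContinuousLinearMap.adjoint_comp,
    Submodule.adjoint_subtypeL, Submodule.adjoint_orthogonalProjectionOnto]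
  rfl

theorem compress₀_eq (L : Submodule ℂ H) [CompleteSpace L] (X : H₀ →L[ℂ] H₀) :
    compress₀ L H₀ X = compress L (extendZero H₀ X) := rfl

end ExtendZero

/-! ### The restricted representation and its commutant -/

section Restrict

variable {G : Type v} [Group G] {H : Type u} [NormedAddCommGroup H] [InnerProductSpace ℂ H]
  [CompleteSpace H]

theorem ProjUnitaryRep.star_op_comm {π : ProjUnitaryRep G H} {g : G} {X : H →L[ℂ] H}
    (h : (π.op g : H →L[ℂ] H) * X = X * (π.op g : H →L[ℂ] H)) :
    star (π.op g : H →L[ℂ] H) * X = X * star (π.op g : H →L[ℂ] H) := by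
  ext x
  have h1 := congrArg (fun T : H →L[ℂ] H => T (star (π.op g : H →L[ℂ] H) x)) h
  simp only [mul_apply_eq_comp, π.op_star_op_self] at h1
  rw [mul_apply_eq_comp, mul_apply_eq_comp, ← h1, π.star_op_op_self]

theorem ProjUnitaryRep.mem_commutant_iff {π : ProjUnitaryRep G H} {Γ : Subgroup G}
    {X : H →L[ℂ] H} :
    X ∈ π.commutant Γ ↔ ∀ γ ∈ Γ, (π.op γ : H →L[ℂ] H) * X = X * (π.op γ : H →L[ℂ] H) := by
  refine (StarSubalgebra.mem_centralizer_iff ℂ).trans ⟨fun h γ hγ => (h _ ⟨γ, hγ, rfl⟩).1, ?_⟩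
  rintro h _ ⟨γ, hγ, rfl⟩
  exact ⟨h γ hγ, ProjUnitaryRep.star_op_comm (h γ hγ)⟩

variable {H₀ : Submodule ℂ H} [CompleteSpace H₀] {π : ProjUnitaryRep G H}
  (hinv : ∀ g, ∀ x ∈ H₀, (π.op g : H →L[ℂ] H) x ∈ H₀)
include hinv

/-- Up to a phase `π(g)*` is `π(g⁻¹)`, so `H₀` is invariant under the adjoints too and hence
reducing. -/
theorem starProjection_comm (g : G) :
    (π.op g : H →L[ℂ] H) * H₀.starProjection = H₀.starProjection * (π.op g : H →L[ℂ] H) := by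
  have h1 : ∀ x ∈ H₀, star (π.op g : H →L[ℂ] H) x ∈ H₀ := by
    intro x hx
    have := π.star_op_op g 1 x
    rw [π.op_one_apply] at this
    rw [this]
    exact H₀.smul_mem _ (hinv _ _ hx)
  ext x
  rw [mul_apply_eq_comp, mul_apply_eq_comp]
  symm
  refine Submodule.eq_starProjection_of_mem_of_inner_eq_zero (hinv g _ (Submodule.coe_mem _)) ?_
  intro w hw
  rw [← map_sub, ← ContinuousLinearMap.adjoint_inner_right, ← ContinuousLinearMap.star_eq_adjoint]
  exact Submodule.starProjection_inner_eq_zero x _ (h1 w hw)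

theorem extendZero_restrict_mul (g : G) (X : H₀ →L[ℂ] H₀) :
    extendZero H₀ (((π.restrict H₀ hinv).op g : H₀ →L[ℂ] H₀) * X) =
      (π.op g : H →L[ℂ] H) * extendZero H₀ X := rfl

theorem extendZero_mul_restrict (g : G) (X : H₀ →L[ℂ] H₀) :
    extendZero H₀ (X * ((π.restrict H₀ hinv).op g : H₀ →L[ℂ] H₀)) =
      extendZero H₀ X * (π.op g : H →L[ℂ] H) := by
  ext x
  have h := congrArg (fun T : H →L[ℂ] H => T x) (starProjection_comm hinv g)
  simp only [mul_apply_eq_comp] at h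
  rw [mul_apply_eq_comp, extendZero_apply, extendZero_apply, mul_apply_eq_comp]
  congr 2
  exact Subtype.ext h

theorem extendZero_comm {Γ : Subgroup G} {X : H₀ →L[ℂ] H₀}
    (hX : X ∈ (π.restrict H₀ hinv).commutant Γ) {γ : G} (hγ : γ ∈ Γ) :
    (π.op γ : H →L[ℂ] H) * extendZero H₀ X = extendZero H₀ X * (π.op γ : H →L[ℂ] H) := by
  rw [← extendZero_restrict_mul hinv, ← extendZero_mul_restrict hinv,
    ProjUnitaryRep.mem_commutant_iff.1 hX γ hγ]

theorem compress_mem_commutant {Γ : Subgroup G} {Y : H →L[ℂ] H}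
    (hY : ∀ γ ∈ Γ, (π.op γ : H →L[ℂ] H) * Y = Y * (π.op γ : H →L[ℂ] H)) :
    compress H₀ Y ∈ (π.restrict H₀ hinv).commutant Γ := by
  refine ProjUnitaryRep.mem_commutant_iff.2 fun γ hγ => ?_
  have hinj : Function.Injective (extendZero H₀) :=
    Function.LeftInverse.injective (compress_extendZero H₀)
  apply hinj
  rw [extendZero_restrict_mul, extendZero_mul_restrict, extendZero_compress, ← mul_assoc,
    ← mul_assoc, starProjection_comm hinv, mul_assoc _ (π.op γ : H →L[ℂ] H) Y, hY γ hγ,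
    mul_assoc _ _ (H₀.starProjection), mul_assoc _ _ (H₀.starProjection),
    starProjection_comm hinv]
  simp only [mul_assoc]

end Restrict

/-! ### The isomorphism `Φ` of `π₀(Γ)'` onto `p(R(Γ) ⊗ B(L))p` -/

section CommutantMap

variable {G : Type v} [Group G] {H : Type u} [NormedAddCommGroup H] [InnerProductSpace ℂ H]
  [CompleteSpace H] {π : ProjUnitaryRep G H} {Γ : Subgroup G} {L : Submodule ℂ H}
  [CompleteSpace L] {H₀ : Submodule ℂ H} [CompleteSpace H₀]

/-- The diagonal operator with blocks `π(k) Y π(k)*`, for `Y ∈ π(Γ)'`. -/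
theorem exists_diagonal_of_commute {Y : H →L[ℂ] H}
    (hY : ∀ γ ∈ Γ, (π.op γ : H →L[ℂ] H) * Y = Y * (π.op γ : H →L[ℂ] H)) :
    ∃ T : lp (fun _ : G ⧸ Γ => H) 2 →L[ℂ] lp (fun _ : G ⧸ Γ => H) 2, ∀ (k : G) (x : H),
      T (lp.single 2 (k : G ⧸ Γ) ((π.op k : H →L[ℂ] H) x)) =
        lp.single 2 (k : G ⧸ Γ) ((π.op k : H →L[ℂ] H) (Y x)) := by
  obtain ⟨T, hT⟩ := exists_diagonal_operator (ι := G ⧸ Γ)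
    (fun y => (π.op y.out : H →L[ℂ] H) * Y * star (π.op y.out : H →L[ℂ] H))
    (C := ‖Y‖) (norm_nonneg _) (fun y => ContinuousLinearMap.opNorm_le_bound _ (norm_nonneg _)
      fun x => by
        rw [mul_apply_eq_comp, mul_apply_eq_comp, π.norm_op_apply]
        refine (Y.le_opNorm _).trans (le_of_eq ?_)
        rw [← π.norm_op_apply y.out, π.op_star_op_self])
  refine ⟨T, fun k x => ?_⟩
  rw [hT]
  congr 1
  -- The block `π(k) Y π(k)*` must not depend on the representative of `kΓ`: two of them differ by
  -- `a ∈ Γ`, and `Y` commutes with `π(a⁻¹)`.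
  obtain ⟨⟨a, ha⟩, h1⟩ := QuotientGroup.mk_out_eq_mul Γ k
  have h2 : (k : G ⧸ Γ).out⁻¹ * k = a⁻¹ := by rw [h1]; group
  have h3 := congrArg (fun T : H →L[ℂ] H => T x) (hY a⁻¹ (inv_mem ha))
  simp only [mul_apply_eq_comp] at h3
  rw [mul_apply_eq_comp, mul_apply_eq_comp, π.star_op_op, h2, map_smul, ← h3, ← h2,
    ← π.star_op_op, π.op_star_op_self]

variable (hS : IsSplitting π Γ L) (hinv : ∀ g, ∀ x ∈ H₀, (π.op g : H →L[ℂ] H) x ∈ H₀)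
include hS

theorem exists_commutantMap_eq {X : H₀ →L[ℂ] H₀} (hX : X ∈ (π.restrict H₀ hinv).commutant Γ) :
    ∃ T : lp (fun _ : G ⧸ Γ => H) 2 →L[ℂ] lp (fun _ : G ⧸ Γ => H) 2,
      (∀ (k : G) (x : H), T (lp.single 2 (k : G ⧸ Γ) ((π.op k : H →L[ℂ] H) x)) =
        lp.single 2 (k : G ⧸ Γ) ((π.op k : H →L[ℂ] H) (extendZero H₀ X x))) ∧
      IsSeries π.cocycle (commutantCoeff π L H₀ hinv Γ X) (hS.conj T) ∧
      commutantMap π L H₀ hinv Γ X = hS.conj T := by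
  obtain ⟨T, hT⟩ := exists_diagonal_of_commute (fun γ hγ => extendZero_comm hinv hX hγ)
  have hs : IsSeries π.cocycle (commutantCoeff π L H₀ hinv Γ X) (hS.conj T) := by
    have h := hS.isSeries_conj (T := T) (f := fun θ => if θ ∈ Γ then 1 else 0)
      (X := extendZero H₀ X) fun k g x => by
        rw [hT]
        split_ifs with h
        · rw [QuotientGroup.eq.2 h, lp.single_apply_self, one_smul]
        · rw [lp.single_apply_ne _ _ _ fun e => h (QuotientGroup.eq.1 e), zero_smul]
    convert! h using 1
    funext θ
    rw [commutantCoeff, compress₀_eq, extendZero_restrict_mul]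
    split_ifs
    · rw [one_smul]
    · exact (zero_smul ℂ (compress L ((π.op θ : H →L[ℂ] H) * extendZero H₀ X))).symm
  exact ⟨T, hT, hs, hs.seriesOp_eq⟩

theorem isSeries_commutantMap {X : H₀ →L[ℂ] H₀} (hX : X ∈ (π.restrict H₀ hinv).commutant Γ) :
    IsSeries π.cocycle (commutantCoeff π L H₀ hinv Γ X) (commutantMap π L H₀ hinv Γ X) := by
  obtain ⟨T, -, h, h'⟩ := exists_commutantMap_eq hS hinv hX
  rwa [h']

theorem commutantMap_mem {X : H₀ →L[ℂ] H₀} (hX : X ∈ (π.restrict H₀ hinv).commutant Γ) :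
    commutantMap π L H₀ hinv Γ X ∈ rightAlg π.cocycle L Γ :=
  (isSeries_commutantMap hS hinv hX).mem_rightAlg fun _ hθ => if_neg hθ

theorem block_commutantMap {X : H₀ →L[ℂ] H₀} (hX : X ∈ (π.restrict H₀ hinv).commutant Γ) :
    hS.block (commutantMap π L H₀ hinv Γ X) = extendZero H₀ X := by
  obtain ⟨T, hT, -, h'⟩ := exists_commutantMap_eq hS hinv hX
  ext x
  have := hT 1 x
  rw [π.op_one_apply, π.op_one_apply] at this
  rw [h', hS.block_conj_apply, this, lp.single_apply_self]

/-- Injectivity of `block` on `R(Γ) ⊗ B(L)` reduces the algebraic identities for `Φ` to identities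
between operators on `H`. -/
theorem eq_commutantMap {X : H₀ →L[ℂ] H₀} (hX : X ∈ (π.restrict H₀ hinv).commutant Γ)
    {T : L2 G L →L[ℂ] L2 G L} (hT : T ∈ rightAlg π.cocycle L Γ)
    (h : hS.block T = extendZero H₀ X) : T = commutantMap π L H₀ hinv Γ X :=
  hS.block_injOn hT (commutantMap_mem hS hinv hX) (h.trans (block_commutantMap hS hinv hX).symm)

theorem commutantMap_add {X Y : H₀ →L[ℂ] H₀} (hX : X ∈ (π.restrict H₀ hinv).commutant Γ)
    (hY : Y ∈ (π.restrict H₀ hinv).commutant Γ) :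
    commutantMap π L H₀ hinv Γ (X + Y) =
      commutantMap π L H₀ hinv Γ X + commutantMap π L H₀ hinv Γ Y := by
  refine (eq_commutantMap hS hinv (add_mem hX hY)
    (add_mem (commutantMap_mem hS hinv hX) (commutantMap_mem hS hinv hY)) ?_).symm
  rw [map_add, block_commutantMap hS hinv hX, block_commutantMap hS hinv hY, extendZero_add]

theorem commutantMap_smul (a : ℂ) {X : H₀ →L[ℂ] H₀}
    (hX : X ∈ (π.restrict H₀ hinv).commutant Γ) :
    commutantMap π L H₀ hinv Γ (a • X) = a • commutantMap π L H₀ hinv Γ X := by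
  refine (eq_commutantMap hS hinv (StarSubalgebra.smul_mem _ hX a)
    (StarSubalgebra.smul_mem _ (commutantMap_mem hS hinv hX) a) ?_).symm
  rw [map_smul, block_commutantMap hS hinv hX, extendZero_smul]

theorem commutantMap_mul {X Y : H₀ →L[ℂ] H₀} (hX : X ∈ (π.restrict H₀ hinv).commutant Γ)
    (hY : Y ∈ (π.restrict H₀ hinv).commutant Γ) :
    commutantMap π L H₀ hinv Γ (X * Y) =
      commutantMap π L H₀ hinv Γ X * commutantMap π L H₀ hinv Γ Y := by
  refine (eq_commutantMap hS hinv (mul_mem hX hY)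
    (mul_mem (commutantMap_mem hS hinv hX) (commutantMap_mem hS hinv hY)) ?_).symm
  rw [hS.block_mul_of_mem_right _ (commutantMap_mem hS hinv hY), block_commutantMap hS hinv hX,
    block_commutantMap hS hinv hY, extendZero_mul]

theorem commutantMap_star {X : H₀ →L[ℂ] H₀} (hX : X ∈ (π.restrict H₀ hinv).commutant Γ) :
    commutantMap π L H₀ hinv Γ (star X) = star (commutantMap π L H₀ hinv Γ X) := by
  refine (eq_commutantMap hS hinv (star_mem hX) (star_mem (commutantMap_mem hS hinv hX)) ?_).symm
  rw [hS.block_star, block_commutantMap hS hinv hX, extendZero_star]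

theorem cutProj_mem : cutProj π L H₀ hinv Γ ∈ rightAlg π.cocycle L Γ :=
  commutantMap_mem hS hinv (one_mem _)

theorem block_cutProj : hS.block (cutProj π L H₀ hinv Γ) = H₀.starProjection :=
  block_commutantMap hS hinv (one_mem _)

theorem isStarProjection_cutProj : IsStarProjection (cutProj π L H₀ hinv Γ) := by
  constructor
  · have := commutantMap_mul hS hinv (one_mem _) (one_mem _)
    rw [mul_one] at this
    exact this.symm
  · have := commutantMap_star hS hinv (one_mem _)
    rw [star_one (H₀ →L[ℂ] H₀)] at this
    exact this.symm

theorem cutProj_mul_commutantMap {X : H₀ →L[ℂ] H₀}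
    (hX : X ∈ (π.restrict H₀ hinv).commutant Γ) :
    cutProj π L H₀ hinv Γ * commutantMap π L H₀ hinv Γ X = commutantMap π L H₀ hinv Γ X := by
  rw [cutProj, ← commutantMap_mul hS hinv (one_mem _) hX, one_mul]

theorem commutantMap_mul_cutProj {X : H₀ →L[ℂ] H₀}
    (hX : X ∈ (π.restrict H₀ hinv).commutant Γ) :
    commutantMap π L H₀ hinv Γ X * cutProj π L H₀ hinv Γ = commutantMap π L H₀ hinv Γ X := by
  rw [cutProj, ← commutantMap_mul hS hinv hX (one_mem _), mul_one]

theorem mem_reducedAlg_iff {Λ : Subgroup G} (hΛ : Γ ≤ Λ) {x : L2 G L →L[ℂ] L2 G L} :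
    x ∈ reducedAlg π L H₀ hinv Γ Λ ↔ x ∈ rightAlg π.cocycle L Λ ∧
      cutProj π L H₀ hinv Γ * x = x ∧ x * cutProj π L H₀ hinv Γ = x := by
  have hp := (isStarProjection_cutProj hS hinv).isIdempotentElem.eq
  have hpm := rightAlg_mono π.cocycle hΛ (cutProj_mem hS hinv)
  constructor
  · rintro ⟨y, hy, rfl⟩
    refine ⟨mul_mem (mul_mem hpm hy) hpm, ?_, ?_⟩
    · rw [← mul_assoc, ← mul_assoc, hp]
    · rw [mul_assoc, hp]
  · rintro ⟨h1, h2, h3⟩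
    exact ⟨x, h1, by rw [h2, h3]⟩

theorem commutantMap_mem_reducedAlg {X : H₀ →L[ℂ] H₀}
    (hX : X ∈ (π.restrict H₀ hinv).commutant Γ) :
    commutantMap π L H₀ hinv Γ X ∈ reducedAlg π L H₀ hinv Γ Γ :=
  (mem_reducedAlg_iff hS hinv le_rfl).2 ⟨commutantMap_mem hS hinv hX,
    cutProj_mul_commutantMap hS hinv hX, commutantMap_mul_cutProj hS hinv hX⟩

theorem block_of_mem_reducedAlg {Λ : Subgroup G} (hΛ : Γ ≤ Λ) {x : L2 G L →L[ℂ] L2 G L}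
    (hx : x ∈ reducedAlg π L H₀ hinv Γ Λ) :
    H₀.starProjection * hS.block x * H₀.starProjection = hS.block x := by
  obtain ⟨-, h2, h3⟩ := (mem_reducedAlg_iff hS hinv hΛ).1 hx
  rw [← block_cutProj hS hinv, ← hS.block_mul_of_mem_left _ (cutProj_mem hS hinv), h2,
    ← hS.block_mul_of_mem_right _ (cutProj_mem hS hinv), h3]

theorem compress_block_mem {Λ : Subgroup G} (hΛ : Γ ≤ Λ) {x : L2 G L →L[ℂ] L2 G L}
    (hx : x ∈ reducedAlg π L H₀ hinv Γ Λ) :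
    compress H₀ (hS.block x) ∈ (π.restrict H₀ hinv).commutant Γ :=
  compress_mem_commutant hinv fun _ hγ =>
    hS.block_op_comm ((mem_reducedAlg_iff hS hinv hΛ).1 hx).1 hγ

theorem extendZero_compress_block {Λ : Subgroup G} (hΛ : Γ ≤ Λ) {x : L2 G L →L[ℂ] L2 G L}
    (hx : x ∈ reducedAlg π L H₀ hinv Γ Λ) :
    extendZero H₀ (compress H₀ (hS.block x)) = hS.block x := by
  rw [extendZero_compress, block_of_mem_reducedAlg hS hinv hΛ hx]

theorem commutantMap_compress_block {x : L2 G L →L[ℂ] L2 G L}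
    (hx : x ∈ reducedAlg π L H₀ hinv Γ Γ) :
    commutantMap π L H₀ hinv Γ (compress H₀ (hS.block x)) = x :=
  (eq_commutantMap hS hinv (compress_block_mem hS hinv le_rfl hx)
    ((mem_reducedAlg_iff hS hinv le_rfl).1 hx).1
    (extendZero_compress_block hS hinv le_rfl hx).symm).symm

/-- The inverse is the compression of the block to `H₀`; it lands in `π₀(Γ)'` because blocks commute
with `π(Γ)`. -/
theorem bijOn_commutantMap :
    Set.BijOn (commutantMap π L H₀ hinv Γ) ((π.restrict H₀ hinv).commutant Γ)
      (reducedAlg π L H₀ hinv Γ Γ) := by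
  refine ⟨fun X hX => commutantMap_mem_reducedAlg hS hinv hX, fun X hX Y hY h => ?_,
    fun x hx => ⟨_, compress_block_mem hS hinv le_rfl hx, commutantMap_compress_block hS hinv hx⟩⟩
  rw [← compress_extendZero H₀ X, ← compress_extendZero H₀ Y, ← block_commutantMap hS hinv hX,
    ← block_commutantMap hS hinv hY, h]

end CommutantMap

/-! ### The representations `S` and `S_p` -/

section Hecke

variable {G : Type v} [Group G] {H : Type u} [NormedAddCommGroup H] [InnerProductSpace ℂ H]
  [CompleteSpace H] {π : ProjUnitaryRep G H} {Γ : Subgroup G} {L : Submodule ℂ H}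
  [CompleteSpace L] {H₀ : Submodule ℂ H} [CompleteSpace H₀]

theorem diagonal_apply {ι E : Type*} [DecidableEq ι] [NormedAddCommGroup E]
    [InnerProductSpace ℂ E] {T : lp (fun _ : ι => E) 2 →L[ℂ] lp (fun _ : ι => E) 2}
    {A : ι → E →L[ℂ] E} (hT : ∀ j x, T (lp.single 2 j x) = lp.single 2 j (A j x))
    (η : lp (fun _ : ι => E) 2) (j : ι) : T η j = A j (η j) := by
  have h1 := hasSum_eval (hasSum_apply_single T η) j
  simp only [hT] at h1
  have h2 := hasSum_single (f := fun i => (lp.single 2 i (A i (η i)) : lp (fun _ : ι => E) 2) j) j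
    (fun i hi => lp.single_apply_ne _ _ _ hi.symm)
  rw [lp.single_apply_self] at h2
  exact h1.unique h2

section Split

variable (hS : IsSplitting π Γ L)
include hS

theorem isSeries_splitHecke_of_actsBy
    {T : lp (fun _ : G ⧸ Γ => H) 2 →L[ℂ] lp (fun _ : G ⧸ Γ => H) 2} {f : G → ℂ}
    (hT : ActsBy T f) :
    IsSeries π.cocycle (fun θ => f θ • compress L (π.op θ : H →L[ℂ] H)) (hS.conj T) := by
  have h := hS.isSeries_conj (T := T) (f := f) (X := 1) fun k g x => hT k g _
  simpa only [mul_one] using h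

/-- This transports the Hecke action on `ℓ²(G/Γ) ⊗ H` to `S`, so linearity, products and adjoints
for `S` become statements about scalar matrices. -/
theorem splitHecke_eq_conj
    {T : lp (fun _ : G ⧸ Γ => H) 2 →L[ℂ] lp (fun _ : G ⧸ Γ => H) 2} {f : G → ℂ}
    (hT : ActsBy T f) : splitHecke π L f = hS.conj T :=
  (isSeries_splitHecke_of_actsBy hS hT).seriesOp_eq

variable (hΓ : IsAlmostNormal Γ)
include hΓ

theorem isSeries_splitHecke {f : G → ℂ} (hf : f ∈ heckeSpace Γ) :
    IsSeries π.cocycle (fun θ => f θ • compress L (π.op θ : H →L[ℂ] H)) (splitHecke π L f) := by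
  obtain ⟨T, hT⟩ := exists_actsBy (H := H) hΓ hf
  rw [splitHecke_eq_conj hS hT]
  exact isSeries_splitHecke_of_actsBy hS hT

theorem splitHecke_mem {f : G → ℂ} (hf : f ∈ heckeSpace Γ) :
    splitHecke π L f ∈ rightAlg π.cocycle L ⊤ :=
  (isSeries_splitHecke hS hΓ hf).mem_rightAlg fun _ hθ => (hθ trivial).elim

theorem splitHecke_add {f h : G → ℂ} (hf : f ∈ heckeSpace Γ) (hh : h ∈ heckeSpace Γ) :
    splitHecke π L (f + h) = splitHecke π L f + splitHecke π L h := by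
  obtain ⟨T, hT⟩ := exists_actsBy (H := H) hΓ hf
  obtain ⟨T', hT'⟩ := exists_actsBy (H := H) hΓ hh
  rw [splitHecke_eq_conj hS hT, splitHecke_eq_conj hS hT',
    splitHecke_eq_conj hS (T := T + T') fun k g x => by simp [hT k g x, hT' k g x, add_smul],
    hS.conj_add]

theorem splitHecke_smul (a : ℂ) {f : G → ℂ} (hf : f ∈ heckeSpace Γ) :
    splitHecke π L (a • f) = a • splitHecke π L f := by
  obtain ⟨T, hT⟩ := exists_actsBy (H := H) hΓ hf
  rw [splitHecke_eq_conj hS hT,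
    splitHecke_eq_conj hS (T := a • T) fun k g x => by simp [hT k g x, mul_smul], hS.conj_smul]

theorem splitHecke_mul {f h : G → ℂ} (hf : f ∈ heckeSpace Γ) (hh : h ∈ heckeSpace Γ) :
    splitHecke π L (heckeMul Γ f h) = splitHecke π L f * splitHecke π L h := by
  obtain ⟨T, hT⟩ := exists_actsBy (H := H) hΓ hf
  obtain ⟨T', hT'⟩ := exists_actsBy (H := H) hΓ hh
  rw [splitHecke_eq_conj hS hT, splitHecke_eq_conj hS hT', splitHecke_eq_conj hS
    (hT.mul hT' (isHeckeFun_of_mem hΓ hf) (isHeckeFun_of_mem hΓ hh)), map_mul]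

theorem splitHecke_star {f : G → ℂ} (hf : f ∈ heckeSpace Γ) :
    splitHecke π L (heckeStar f) = star (splitHecke π L f) := by
  obtain ⟨T, hT⟩ := exists_actsBy (H := H) hΓ hf
  rw [splitHecke_eq_conj hS hT, splitHecke_eq_conj hS hT.star, hS.conj_star]

end Split

theorem splitHecke_one (hS : IsSplitting π Γ L) : splitHecke π L (dcosetFun Γ 1) = 1 := by
  rw [splitHecke_eq_conj hS ActsBy.one, map_one]

section Reduced

variable (hS : IsSplitting π Γ L) (hinv : ∀ g, ∀ x ∈ H₀, (π.op g : H →L[ℂ] H) x ∈ H₀)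
include hS

theorem exists_commutantMap_eq_diagonal {X : H₀ →L[ℂ] H₀}
    (hX : X ∈ (π.restrict H₀ hinv).commutant Γ) :
    ∃ T : lp (fun _ : G ⧸ Γ => H) 2 →L[ℂ] lp (fun _ : G ⧸ Γ => H) 2,
      (∀ (y : G ⧸ Γ) (x : H), T (lp.single 2 y x) = lp.single 2 y
        (((π.op y.out : H →L[ℂ] H) * extendZero H₀ X * star (π.op y.out : H →L[ℂ] H)) x)) ∧
      commutantMap π L H₀ hinv Γ X = hS.conj T := by
  obtain ⟨T, hT, -, h⟩ := exists_commutantMap_eq hS hinv hX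
  refine ⟨T, fun y x => ?_, h⟩
  have := hT y.out (star (π.op y.out : H →L[ℂ] H) x)
  rwa [QuotientGroup.out_eq', π.op_star_op_self] at this

/-- The blocks `π(y) p π(y)*` all equal `p` since `H₀` is `G`-invariant. A constant diagonal
commutes with scalar matrices, hence `p` commutes with every `S(f)`. -/
theorem exists_cutProj_eq_diagonal :
    ∃ T : lp (fun _ : G ⧸ Γ => H) 2 →L[ℂ] lp (fun _ : G ⧸ Γ => H) 2,
      (∀ (y : G ⧸ Γ) (x : H), T (lp.single 2 y x) = lp.single 2 y (H₀.starProjection x)) ∧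
      cutProj π L H₀ hinv Γ = hS.conj T := by
  obtain ⟨T, hT, h⟩ := exists_commutantMap_eq_diagonal hS hinv (one_mem _)
  refine ⟨T, fun y x => ?_, h⟩
  rw [hT, extendZero_one, starProjection_comm hinv, mul_assoc,
    Unitary.mul_star_self_of_mem (π.op y.out).2, mul_one]

variable (hΓ : IsAlmostNormal Γ)
include hΓ

theorem cutProj_comm_splitHecke {f : G → ℂ} (hf : f ∈ heckeSpace Γ) :
    cutProj π L H₀ hinv Γ * splitHecke π L f = splitHecke π L f * cutProj π L H₀ hinv Γ := by
  obtain ⟨T, hT⟩ := exists_actsBy (H := H) hΓ hf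
  obtain ⟨D, hD, h⟩ := exists_cutProj_eq_diagonal hS hinv
  rw [splitHecke_eq_conj hS hT, h, ← map_mul, ← map_mul]
  congr 1
  refine ext_single fun k x => ?_
  ext g
  obtain ⟨k, rfl⟩ := QuotientGroup.mk_surjective k
  obtain ⟨g, rfl⟩ := QuotientGroup.mk_surjective g
  rw [mul_apply_eq_comp, diagonal_apply hD, mul_apply_eq_comp, hD, hT, hT, map_smul]

theorem reducedHecke_eq {f : G → ℂ} (hf : f ∈ heckeSpace Γ) :
    reducedHecke π L H₀ hinv Γ f = splitHecke π L f * cutProj π L H₀ hinv Γ := by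
  rw [reducedHecke, cutProj_comm_splitHecke hS hinv hΓ hf, mul_assoc,
    (isStarProjection_cutProj hS hinv).isIdempotentElem.eq]

theorem isSeries_reducedHecke {f : G → ℂ} (hf : f ∈ heckeSpace Γ) :
    IsSeries π.cocycle (fun θ => f θ • compress₀ L H₀
      ((π.restrict H₀ hinv).op θ : H₀ →L[ℂ] H₀)) (reducedHecke π L H₀ hinv Γ f) := by
  obtain ⟨T, hT⟩ := exists_actsBy (H := H) hΓ hf
  obtain ⟨D, hD, h⟩ := exists_cutProj_eq_diagonal hS hinv
  rw [reducedHecke_eq hS hinv hΓ hf, splitHecke_eq_conj hS hT, h, ← map_mul]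
  have h2 := hS.isSeries_conj (T := T * D) (f := f) (X := H₀.starProjection) fun k g x => by
    have h3 := congrArg (fun T : H →L[ℂ] H => T x) (starProjection_comm hinv k)
    simp only [mul_apply_eq_comp] at h3
    rw [mul_apply_eq_comp, hD, hT, h3]
  exact h2

theorem reducedHecke_mem {f : G → ℂ} (hf : f ∈ heckeSpace Γ) :
    reducedHecke π L H₀ hinv Γ f ∈ reducedAlg π L H₀ hinv Γ ⊤ :=
  ⟨_, splitHecke_mem hS hΓ hf, rfl⟩

theorem reducedHecke_add {f h : G → ℂ} (hf : f ∈ heckeSpace Γ) (hh : h ∈ heckeSpace Γ) :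
    reducedHecke π L H₀ hinv Γ (f + h) =
      reducedHecke π L H₀ hinv Γ f + reducedHecke π L H₀ hinv Γ h := by
  rw [reducedHecke, splitHecke_add hS hΓ hf hh, mul_add, add_mul]
  rfl

theorem reducedHecke_smul (a : ℂ) {f : G → ℂ} (hf : f ∈ heckeSpace Γ) :
    reducedHecke π L H₀ hinv Γ (a • f) = a • reducedHecke π L H₀ hinv Γ f := by
  rw [reducedHecke, splitHecke_smul hS hΓ a hf, mul_smul_comm, smul_mul_assoc]
  rfl

theorem reducedHecke_mul {f h : G → ℂ} (hf : f ∈ heckeSpace Γ) (hh : h ∈ heckeSpace Γ) :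
    reducedHecke π L H₀ hinv Γ (heckeMul Γ f h) =
      reducedHecke π L H₀ hinv Γ f * reducedHecke π L H₀ hinv Γ h := by
  have hp := (isStarProjection_cutProj hS hinv).isIdempotentElem.eq
  have hc := cutProj_comm_splitHecke hS hinv hΓ hf
  rw [reducedHecke, splitHecke_mul hS hΓ hf hh, reducedHecke_eq hS hinv hΓ hf, reducedHecke,
    ← mul_assoc, hc]
  simp only [mul_assoc]
  rw [← mul_assoc (cutProj π L H₀ hinv Γ) (cutProj π L H₀ hinv Γ), hp]

theorem reducedHecke_star {f : G → ℂ} (hf : f ∈ heckeSpace Γ) :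
    reducedHecke π L H₀ hinv Γ (heckeStar f) = star (reducedHecke π L H₀ hinv Γ f) := by
  have hp := (isStarProjection_cutProj hS hinv).isSelfAdjoint.star_eq
  have h := star_mul (cutProj π L H₀ hinv Γ * splitHecke π L f) (cutProj π L H₀ hinv Γ)
  have h' := star_mul (cutProj π L H₀ hinv Γ) (splitHecke π L f)
  rw [reducedHecke, splitHecke_star hS hΓ hf, reducedHecke, h, h', hp, mul_assoc]

omit hΓ in
theorem reducedHecke_one :
    reducedHecke π L H₀ hinv Γ (dcosetFun Γ 1) = cutProj π L H₀ hinv Γ := by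
  rw [reducedHecke, splitHecke_one hS, mul_one,
    (isStarProjection_cutProj hS hinv).isIdempotentElem.eq]

end Reduced

end Hecke

/-! ### Existence and uniqueness of the conditional expectation -/

section ConditionalExpectation

/-- The square root lies in every commutant containing `X`, so `Φ` can be applied to it; positivity
of `Φ(X)` follows as `Φ(Q)* Φ(Q)`. -/
theorem exists_star_mul_self_eq {E : Type*} [NormedAddCommGroup E] [InnerProductSpace ℂ E]
    [CompleteSpace E] {X : E →L[ℂ] E} (hX : X.IsPositive) :
    ∃ Q : E →L[ℂ] E, star Q * Q = X ∧ ∀ B, B * X = X * B → B * Q = Q * B := by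
  have h0 : 0 ≤ X := (ContinuousLinearMap.nonneg_iff_isPositive X).2 hX
  refine ⟨CFC.sqrt X, ?_, fun B hB => (Commute.cfcₙ_nnreal (Commute.symm hB) _).symm⟩
  rw [(IsSelfAdjoint.of_nonneg (CFC.sqrt_nonneg X)).star_eq, CFC.sqrt_mul_sqrt_self X h0]

theorem compress_add {H : Type u} [NormedAddCommGroup H] [InnerProductSpace ℂ H]
    {H₀ : Submodule ℂ H} [CompleteSpace H₀] (X Y : H →L[ℂ] H) :
    compress H₀ (X + Y) = compress H₀ X + compress H₀ Y := by
  ext x; simp [compress_apply]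

theorem compress_smul {H : Type u} [NormedAddCommGroup H] [InnerProductSpace ℂ H]
    {H₀ : Submodule ℂ H} [CompleteSpace H₀] (a : ℂ) (X : H →L[ℂ] H) :
    compress H₀ (a • X) = a • compress H₀ X := by
  ext x; simp [compress_apply]

theorem HasTrace.sub {G : Type v} [Group G] {V : Type u} [NormedAddCommGroup V]
    [InnerProductSpace ℂ V] {x y : L2 G V →L[ℂ] L2 G V} {s t : ℂ} (hx : HasTrace x s)
    (hy : HasTrace y t) : HasTrace (x - y) (s - t) := by
  intro ι b
  convert! (hx ι b).sub (hy ι b) using 2 with i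
  rw [← inner_sub_right]
  rfl

variable {G : Type v} [Group G] {H : Type u} [NormedAddCommGroup H] [InnerProductSpace ℂ H]
  [CompleteSpace H] {π : ProjUnitaryRep G H} {Γ : Subgroup G} {L : Submodule ℂ H}
  [CompleteSpace L] {H₀ : Submodule ℂ H} [CompleteSpace H₀]

theorem commutantMap_isPositive (hS : IsSplitting π Γ L)
    (hinv : ∀ g, ∀ x ∈ H₀, (π.op g : H →L[ℂ] H) x ∈ H₀) {X : H₀ →L[ℂ] H₀}
    (hX : X ∈ (π.restrict H₀ hinv).commutant Γ) (hpos : X.IsPositive) :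
    (commutantMap π L H₀ hinv Γ X).IsPositive := by
  obtain ⟨Q, hQX, hQ⟩ := exists_star_mul_self_eq hpos
  have hQc : Q ∈ (π.restrict H₀ hinv).commutant Γ :=
    ProjUnitaryRep.mem_commutant_iff.2 fun γ hγ =>
      hQ _ (ProjUnitaryRep.mem_commutant_iff.1 hX γ hγ)
  rw [← hQX, commutantMap_mul hS hinv (star_mem hQc) hQc, commutantMap_star hS hinv hQc]
  exact ContinuousLinearMap.isPositive_adjoint_comp_self _

variable (hS : IsSplitting π Γ L) (hinv : ∀ g, ∀ x ∈ H₀, (π.op g : H →L[ℂ] H) x ∈ H₀)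

/-- The conditional expectation of `p(R(G) ⊗ B(L))p` onto `p(R(Γ) ⊗ B(L))p`. -/
def condExp : reducedAlg π L H₀ hinv Γ ⊤ →ₗ[ℂ] reducedAlg π L H₀ hinv Γ Γ where
  toFun x := ⟨commutantMap π L H₀ hinv Γ (compress H₀ (hS.block x)),
    commutantMap_mem_reducedAlg hS hinv (compress_block_mem hS hinv le_top x.2)⟩
  map_add' x y := by
    have h := commutantMap_add hS hinv (compress_block_mem hS hinv le_top x.2)
      (compress_block_mem hS hinv le_top y.2)
    rw [← compress_add, ← map_add] at h
    exact Subtype.ext h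
  map_smul' a x := by
    have h := commutantMap_smul hS hinv a (compress_block_mem hS hinv le_top x.2)
    rw [← compress_smul, ← map_smul] at h
    exact Subtype.ext h

theorem condExp_apply (x : reducedAlg π L H₀ hinv Γ ⊤) :
    (condExp hS hinv x : L2 G L →L[ℂ] L2 G L) =
      commutantMap π L H₀ hinv Γ (compress H₀ (hS.block x)) := rfl

theorem block_condExp (x : reducedAlg π L H₀ hinv Γ ⊤) :
    hS.block (condExp hS hinv x : L2 G L →L[ℂ] L2 G L) = hS.block x := by
  rw [condExp_apply, block_commutantMap hS hinv (compress_block_mem hS hinv le_top x.2),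
    extendZero_compress_block hS hinv le_top x.2]

include hS in
theorem mem_rightAlg_of_mem_reducedAlg {Λ : Subgroup G} (hΛ : Γ ≤ Λ)
    {x : L2 G L →L[ℂ] L2 G L} (hx : x ∈ reducedAlg π L H₀ hinv Γ Λ) :
    x ∈ rightAlg π.cocycle L Λ :=
  ((mem_reducedAlg_iff hS hinv hΛ).1 hx).1

/-- `condExp` does not change the block, and the trace depends only on the block. The bimodule law
holds because `block` is multiplicative against, and injective on, `R(Γ) ⊗ B(L)`. -/
theorem isCondExp_condExp :
    IsCondExp (reducedAlg π L H₀ hinv Γ ⊤) (reducedAlg π L H₀ hinv Γ Γ) (condExp hS hinv) where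
  map_of_mem x hx := commutantMap_compress_block hS hinv hx
  bimodule a ha b hb x y h := by
    have ha' := mem_rightAlg_of_mem_reducedAlg hS hinv le_rfl ha
    have hb' := mem_rightAlg_of_mem_reducedAlg hS hinv le_rfl hb
    have hE := fun z => mem_rightAlg_of_mem_reducedAlg hS hinv le_rfl (condExp hS hinv z).2
    refine hS.block_injOn (hE y) (mul_mem (mul_mem ha' (hE x)) hb') ?_
    rw [block_condExp, h, hS.block_mul_of_mem_right _ hb', hS.block_mul_of_mem_left _ ha',
      hS.block_mul_of_mem_right _ hb', hS.block_mul_of_mem_left _ ha', block_condExp]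
  positive x hx := by
    refine commutantMap_isPositive hS hinv (compress_block_mem hS hinv le_top x.2) ?_
    have h1 : (hS.block (x : L2 G L →L[ℂ] L2 G L)).IsPositive := hx.adjoint_conj hS.base
    have h2 := h1.adjoint_conj H₀.subtypeL
    rwa [Submodule.adjoint_subtypeL] at h2
  trace x t h := by
    rw [hS.hasTrace_iff] at h ⊢
    rwa [block_condExp]

include hS in
theorem exists_hasTrace (htr : IsTraceClass (H₀.starProjection ∘L L.starProjection))
    {x : L2 G L →L[ℂ] L2 G L} (hx : x ∈ reducedAlg π L H₀ hinv Γ ⊤) : ∃ t, HasTrace x t := by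
  obtain ⟨t, ht⟩ := exists_hasSum_compression L H₀ htr (hS.block x)
  refine ⟨t, (hS.hasTrace_iff x t).2 ?_⟩
  rwa [block_of_mem_reducedAlg hS hinv le_top hx] at ht

/-- The trace is faithful. -/
theorem eq_zero_of_hasTrace (hS : IsSplitting π Γ L) {Λ : Subgroup G}
    {x : L2 G L →L[ℂ] L2 G L} (hx : x ∈ rightAlg π.cocycle L Λ) (h : HasTrace (star x * x) 0) :
    x = 0 := by
  obtain ⟨w, b, -⟩ := exists_hilbertBasis ℂ L
  have hre := Complex.hasSum_re (h w b)
  have hterm : ∀ v : L, (inner ℂ (lp.single 2 (1 : G) v : L2 G L)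
      ((star x * x) (lp.single 2 (1 : G) v)) : ℂ).re =
      ‖x (lp.single 2 (1 : G) v)‖ ^ 2 := by
    intro v
    rw [mul_apply_eq_comp, ContinuousLinearMap.star_eq_adjoint,
      ContinuousLinearMap.adjoint_inner_right, inner_self_eq_norm_sq_to_K]
    norm_cast
  simp only [hterm, Complex.zero_re] at hre
  have hz := (hasSum_zero_iff_of_nonneg fun i => by positivity).1 hre
  have hxb : ∀ i, x (lp.single 2 (1 : G) (b i)) = 0 := fun i => by
    simpa using congrFun hz i
  refine hS.eq_zero_of_mem_rightAlg hx fun v => ?_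
  let A : L →L[ℂ] L2 G L := x ∘L lp.singleContinuousLinearMap ℂ (fun _ : G => L) 2 (1 : G)
  have hA : A = 0 := by
    refine ContinuousLinearMap.ext_on (s := Set.range b)
      (Submodule.dense_iff_topologicalClosure_eq_top.2 b.dense_span) ?_
    rintro _ ⟨i, rfl⟩
    exact hxb i
  exact congrArg (fun B : L →L[ℂ] L2 G L => B v) hA

include hS in
-- For `d = E'(x) - E(x)`, both `E(d*x)` and `E'(d*x)` have the trace of `d*x`, which exists by
-- finiteness. Their difference `d*d` therefore has trace zero, and faithfulness gives `d = 0`.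
theorem condExp_unique (htr : IsTraceClass (H₀.starProjection ∘L L.starProjection))
    {E E' : reducedAlg π L H₀ hinv Γ ⊤ →ₗ[ℂ] reducedAlg π L H₀ hinv Γ Γ}
    (hE : IsCondExp _ _ E) (hE' : IsCondExp _ _ E') : E' = E := by
  ext1 x
  refine Subtype.ext ?_
  set d : L2 G L →L[ℂ] L2 G L := (E' x : L2 G L →L[ℂ] L2 G L) - E x with hd
  have hdN : d ∈ reducedAlg π L H₀ hinv Γ Γ := sub_mem (E' x).2 (E x).2
  obtain ⟨hdR, hpd, hdp⟩ := (mem_reducedAlg_iff hS hinv le_rfl).1 hdN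
  have hps := (isStarProjection_cutProj hS hinv).isSelfAdjoint.star_eq
  have hds : star d ∈ reducedAlg π L H₀ hinv Γ Γ := by
    refine (mem_reducedAlg_iff hS hinv le_rfl).2 ⟨star_mem hdR, ?_, ?_⟩
    · have h := star_mul d (cutProj π L H₀ hinv Γ)
      rwa [hdp, hps, eq_comm] at h
    · have h := star_mul (cutProj π L H₀ hinv Γ) d
      rwa [hpd, hps, eq_comm] at h
  have hpN : cutProj π L H₀ hinv Γ ∈ reducedAlg π L H₀ hinv Γ Γ :=
    commutantMap_mem_reducedAlg hS hinv (one_mem _)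
  obtain ⟨hxR, hpx, hxp⟩ := (mem_reducedAlg_iff hS hinv le_top).1 x.2
  obtain ⟨hdsR, -, hdsp⟩ := (mem_reducedAlg_iff hS hinv le_rfl).1 hds
  -- The factor `p` on the right is the unit of the corner, present only to fit the two-sided
  -- bimodule law.
  let y : reducedAlg π L H₀ hinv Γ ⊤ :=
    ⟨star d * x * cutProj π L H₀ hinv Γ, (mem_reducedAlg_iff hS hinv le_top).2 <| by
      rw [mul_assoc, hxp]
      refine ⟨mul_mem (rightAlg_mono π.cocycle le_top hdsR) hxR, ?_, ?_⟩
      · rw [← mul_assoc, ((mem_reducedAlg_iff hS hinv le_rfl).1 hds).2.1]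
      · rw [mul_assoc, hxp]⟩
  obtain ⟨t, ht⟩ := exists_hasTrace hS hinv htr y.2
  have h1 := hE.trace y t ht
  have h2 := hE'.trace y t ht
  rw [hE.bimodule _ hds _ hpN x y rfl] at h1
  rw [hE'.bimodule _ hds _ hpN x y rfl] at h2
  have h3 := h2.sub h1
  rw [← sub_mul, ← mul_sub, ← hd, mul_assoc, hdp, sub_self] at h3
  exact sub_eq_zero.1 (eq_zero_of_hasTrace hS hdR h3)

end ConditionalExpectation

/-! ### The classical Hecke operators -/

section ClassicalHecke

variable {G : Type v} [Group G] {H : Type u} [NormedAddCommGroup H] [InnerProductSpace ℂ H]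
  [CompleteSpace H] {π : ProjUnitaryRep G H} {Γ : Subgroup G} {L : Submodule ℂ H}
  [CompleteSpace L] {H₀ : Submodule ℂ H} [CompleteSpace H₀]
  (hS : IsSplitting π Γ L) (hinv : ∀ g, ∀ x ∈ H₀, (π.op g : H →L[ℂ] H) x ∈ H₀)
  (hΓ : IsAlmostNormal Γ)

theorem extendZero_conj_restrict (g : G) (X : H₀ →L[ℂ] H₀) :
    extendZero H₀ (((π.restrict H₀ hinv).op g : H₀ →L[ℂ] H₀) * X *
        star ((π.restrict H₀ hinv).op g : H₀ →L[ℂ] H₀)) =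
      (π.op g : H →L[ℂ] H) * extendZero H₀ X * star (π.op g : H →L[ℂ] H) := by
  have h : extendZero H₀ (X * star ((π.restrict H₀ hinv).op g : H₀ →L[ℂ] H₀)) =
      extendZero H₀ X * star (π.op g : H →L[ℂ] H) := by
    have h1 := congrArg star (extendZero_restrict_mul hinv g (star X))
    have h2 := star_mul ((π.restrict H₀ hinv).op g : H₀ →L[ℂ] H₀) (star X)
    have h3 := star_mul (π.op g : H →L[ℂ] H) (extendZero H₀ (star X))
    rw [← extendZero_star, h2, h3, star_star X, ← extendZero_star, star_star X] at h1
    exact h1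
  rw [mul_assoc, extendZero_restrict_mul, h, mul_assoc]

include hΓ in
theorem hasSum_extendZero_classicalHecke (σ : G) (X : H₀ →L[ℂ] H₀) (z : H) :
    HasSum (fun w : G ⧸ Γ => dcosetFun Γ σ w.out •
      ((π.op w.out : H →L[ℂ] H) * extendZero H₀ X * star (π.op w.out : H →L[ℂ] H)) z)
      (extendZero H₀ ((π.restrict H₀ hinv).classicalHecke Γ σ X) z) := by
  have : Fintype {y : G ⧸ Γ // y.out ∈ dcoset Γ σ} := (hΓ.finite_dcoset σ).fintype
  have h1 : extendZero H₀ ((π.restrict H₀ hinv).classicalHecke Γ σ X) z =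
      ∑ y : {y : G ⧸ Γ // y.out ∈ dcoset Γ σ}, ((π.op y.1.out : H →L[ℂ] H) * extendZero H₀ X *
        star (π.op y.1.out : H →L[ℂ] H)) z := by
    simp only [← extendZero_conj_restrict hinv, extendZero_apply]
    rw [ProjUnitaryRep.classicalHecke, finsum_eq_sum_of_fintype, sum_apply]
    simp
  rw [h1]
  have h2 := hasSum_fintype fun y : {y : G ⧸ Γ // y.out ∈ dcoset Γ σ} =>
    ((π.op y.1.out : H →L[ℂ] H) * extendZero H₀ X * star (π.op y.1.out : H →L[ℂ] H)) z
  have hinj : Function.Injective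
    (Subtype.val : {y : G ⧸ Γ // y.out ∈ dcoset Γ σ} → G ⧸ Γ) := Subtype.val_injective
  refine (hinj.hasSum_iff (f := fun w : G ⧸ Γ => dcosetFun Γ σ w.out •
    ((π.op w.out : H →L[ℂ] H) * extendZero H₀ X * star (π.op w.out : H →L[ℂ] H)) z) ?_).1 ?_
  · intro w hw
    rw [dcosetFun_apply, if_neg, zero_smul]
    intro h
    exact hw ⟨⟨w, h⟩, rfl⟩
  · convert! h2 using 2 with w
    rw [Function.comp_apply, dcosetFun_apply, if_pos w.2, one_smul]

include hΓ in
-- The trivial-coset entry of (Hecke matrix)·(diagonal)·(Hecke matrix)* is a single sum over cosets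
-- `w`. The indicator occurs twice, but it is real and idempotent, so `π(w) X π(w)*` is counted once
-- for each `wΓ` in `ΓσΓ`.
theorem block_splitHecke_conj (σ : G) {X : H₀ →L[ℂ] H₀}
    (hX : X ∈ (π.restrict H₀ hinv).commutant Γ) :
    hS.block (splitHecke π L (dcosetFun Γ σ) * (commutantMap π L H₀ hinv Γ X *
        star (splitHecke π L (dcosetFun Γ σ)))) =
      extendZero H₀ ((π.restrict H₀ hinv).classicalHecke Γ σ X) := by
  obtain ⟨T, hT⟩ := exists_actsBy_dcosetFun (H := H) hΓ σ
  obtain ⟨D, hD, h⟩ := exists_commutantMap_eq_diagonal hS hinv hX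
  rw [splitHecke_eq_conj hS hT, h, ← hS.conj_star, ← map_mul, ← map_mul]
  ext z
  rw [hS.block_conj_apply]
  refine (hT.hasSum_mul 1 1 z).unique ?_
  convert! hasSum_extendZero_classicalHecke hinv hΓ σ X z using 2 with w
  have h1 := hT.star 1 w.out z
  rw [QuotientGroup.out_eq'] at h1
  rw [mul_apply_eq_comp, diagonal_apply hD, h1, map_smul, smul_smul, inv_one, one_mul, mul_one,
    heckeStar, inv_inv]
  congr 1
  rw [dcosetFun_apply]
  split_ifs <;> simp

include hS hΓ in
-- The inner copies of `p` are absorbed by `Φ(X)`, the outer ones by compression to `H₀`. Invariance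
-- of `π₀(Γ)'` under `Ψ` comes for free: the result is the compressed block of an element of `p(R(G)
-- ⊗ B(L))p`.
theorem condExp_reducedHecke_conj (σ : G) {X : H₀ →L[ℂ] H₀}
    (hX : X ∈ (π.restrict H₀ hinv).commutant Γ) :
    (π.restrict H₀ hinv).classicalHecke Γ σ X ∈ (π.restrict H₀ hinv).commutant Γ ∧
    ∃ hM : reducedHecke π L H₀ hinv Γ (dcosetFun Γ σ) * commutantMap π L H₀ hinv Γ X *
        star (reducedHecke π L H₀ hinv Γ (dcosetFun Γ σ)) ∈ reducedAlg π L H₀ hinv Γ ⊤,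
      (condExp hS hinv ⟨_, hM⟩ : L2 G L →L[ℂ] L2 G L) =
        commutantMap π L H₀ hinv Γ ((π.restrict H₀ hinv).classicalHecke Γ σ X) := by
  have hf := dcosetFun_mem (Γ := Γ) σ
  have hSm := splitHecke_mem hS hΓ hf
  have hΦ := rightAlg_mono π.cocycle le_top (commutantMap_mem hS hinv hX)
  have hp := (isStarProjection_cutProj hS hinv).isSelfAdjoint.star_eq
  have heq : reducedHecke π L H₀ hinv Γ (dcosetFun Γ σ) * commutantMap π L H₀ hinv Γ X *
      star (reducedHecke π L H₀ hinv Γ (dcosetFun Γ σ)) =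
      cutProj π L H₀ hinv Γ * (splitHecke π L (dcosetFun Γ σ) * (commutantMap π L H₀ hinv Γ X *
        star (splitHecke π L (dcosetFun Γ σ)))) * cutProj π L H₀ hinv Γ := by
    have h := star_mul (cutProj π L H₀ hinv Γ * splitHecke π L (dcosetFun Γ σ))
      (cutProj π L H₀ hinv Γ)
    have h' := star_mul (cutProj π L H₀ hinv Γ) (splitHecke π L (dcosetFun Γ σ))
    rw [reducedHecke, h, h', hp]
    simp only [mul_assoc]
    rw [← mul_assoc (cutProj π L H₀ hinv Γ) (commutantMap π L H₀ hinv Γ X),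
      cutProj_mul_commutantMap hS hinv hX,
      ← mul_assoc (commutantMap π L H₀ hinv Γ X) (cutProj π L H₀ hinv Γ),
      commutantMap_mul_cutProj hS hinv hX]
  have hM : reducedHecke π L H₀ hinv Γ (dcosetFun Γ σ) * commutantMap π L H₀ hinv Γ X *
      star (reducedHecke π L H₀ hinv Γ (dcosetFun Γ σ)) ∈ reducedAlg π L H₀ hinv Γ ⊤ :=
    ⟨_, mul_mem hSm (mul_mem hΦ (star_mem hSm)), heq⟩
  have hpR := cutProj_mem hS (H₀ := H₀) hinv
  have hb : hS.block (reducedHecke π L H₀ hinv Γ (dcosetFun Γ σ) *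
      commutantMap π L H₀ hinv Γ X * star (reducedHecke π L H₀ hinv Γ (dcosetFun Γ σ))) =
      extendZero H₀ ((π.restrict H₀ hinv).classicalHecke Γ σ X) := by
    rw [heq, hS.block_mul_of_mem_right _ hpR, hS.block_mul_of_mem_left _ hpR,
      block_splitHecke_conj hS hinv hΓ σ hX, block_cutProj, ← extendZero_compress,
      compress_extendZero]
  have hc := compress_block_mem hS hinv le_top hM
  rw [hb, compress_extendZero] at hc
  refine ⟨hc, hM, ?_⟩
  rw [condExp_apply, hb, compress_extendZero]

include hS hΓ in
theorem star_reducedHecke_dcosetFun {σ : G} (hσ : σ⁻¹ ∈ dcoset Γ σ) :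
    star (reducedHecke π L H₀ hinv Γ (dcosetFun Γ σ)) =
      reducedHecke π L H₀ hinv Γ (dcosetFun Γ σ) := by
  rw [← reducedHecke_star hS hinv hΓ (dcosetFun_mem σ)]
  congr 1
  funext x
  rw [heckeStar, dcosetFun_apply, dcosetFun_apply, inv_mem_dcoset, dcoset_eq_of_mem hσ]
  split_ifs <;> simp

end ClassicalHecke

end

end HeckeVN

/-! ### Assembly of the theorem -/

theorem mainTheorem1 {G : Type v} [Group G] {H : Type u} [NormedAddCommGroup H]
    [InnerProductSpace ℂ H] [CompleteSpace H]
    (Γ : Subgroup G) (hΓ : HeckeVN.IsAlmostNormal Γ)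
    (π : HeckeVN.ProjUnitaryRep G H)
    -- `L` is a closed, `Γ`-wandering and generating subspace: `H = ℓ²(Γ) ⊗ L`
    (L : Submodule ℂ H) [CompleteSpace L]
    (hwand : ∀ γ ∈ Γ, γ ≠ 1 → ∀ x ∈ L, ∀ y ∈ L, inner ℂ ((π.op γ : H →L[ℂ] H) x) y = 0)
    (hgen : (Submodule.span ℂ
      {z : H | ∃ γ ∈ Γ, ∃ x ∈ L, z = (π.op γ : H →L[ℂ] H) x}).topologicalClosure = ⊤)
    -- `H₀ = pH` is a closed `G`-invariant subspace, and `p P_L` is trace class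
    (H₀ : Submodule ℂ H) [CompleteSpace H₀]
    (hinv : ∀ g, ∀ x ∈ H₀, (π.op g : H →L[ℂ] H) x ∈ H₀)
    (htr : HeckeVN.IsTraceClass (H₀.starProjection ∘L L.starProjection)) :
    let π₀ := π.restrict H₀ hinv
    let p := HeckeVN.cutProj π L H₀ hinv Γ
    let Φ := HeckeVN.commutantMap π L H₀ hinv Γ
    let S := HeckeVN.splitHecke π L
    let Sp := HeckeVN.reducedHecke π L H₀ hinv Γ
    let M := HeckeVN.reducedAlg π L H₀ hinv Γ ⊤
    let N := HeckeVN.reducedAlg π L H₀ hinv Γ Γ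
    -- `p` is a projection, and `Φ` is a `*`-isomorphism of `π₀(Γ)'` onto `p(R(Γ) ⊗ B(L))p`
    IsStarProjection p ∧ p ∈ HeckeVN.rightAlg π.cocycle L Γ ∧
    (∀ X ∈ π₀.commutant Γ,
      HeckeVN.IsSeries π.cocycle (HeckeVN.commutantCoeff π L H₀ hinv Γ X) (Φ X)) ∧
    Set.BijOn Φ (π₀.commutant Γ) N ∧
    (∀ X ∈ π₀.commutant Γ, ∀ Y ∈ π₀.commutant Γ, ∀ a : ℂ,
      Φ (X + Y) = Φ X + Φ Y ∧ Φ (a • X) = a • Φ X ∧ Φ (X * Y) = Φ X * Φ Y ∧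
      Φ (star X) = star (Φ X)) ∧
    -- `S` and `S_p` are given by their series, and `S_p` is a unital `*`-representation of the
    -- Hecke algebra in `p(R(G) ⊗ B(L))p`
    (∀ f ∈ HeckeVN.heckeSpace Γ,
      HeckeVN.IsSeries π.cocycle
        (fun θ => f θ • HeckeVN.compress L (π.op θ : H →L[ℂ] H)) (S f) ∧
      HeckeVN.IsSeries π.cocycle
        (fun θ => f θ • HeckeVN.compress₀ L H₀ (π₀.op θ : H₀ →L[ℂ] H₀)) (Sp f) ∧
      S f ∈ HeckeVN.rightAlg π.cocycle L ⊤ ∧ Sp f ∈ M) ∧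
    Sp (HeckeVN.dcosetFun Γ 1) = p ∧
    (∀ f ∈ HeckeVN.heckeSpace Γ, ∀ h ∈ HeckeVN.heckeSpace Γ, ∀ a : ℂ,
      Sp (f + h) = Sp f + Sp h ∧ Sp (a • f) = a • Sp f ∧
      Sp (HeckeVN.heckeMul Γ f h) = Sp f * Sp h ∧
      Sp (HeckeVN.heckeStar f) = star (Sp f)) ∧
    -- the trace of `p(R(G) ⊗ B(L))p` is finite
    (∀ x ∈ M, ∃ t : ℂ, HeckeVN.HasTrace x t) ∧
    -- the trace preserving conditional expectation exists, is unique, and gives the classical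
    -- Hecke operators
    ∃ E : M →ₗ[ℂ] N, HeckeVN.IsCondExp M N E ∧
      (∀ E' : M →ₗ[ℂ] N, HeckeVN.IsCondExp M N E' → E' = E) ∧
      ∀ σ : G, ∀ X ∈ π₀.commutant Γ,
        π₀.classicalHecke Γ σ X ∈ π₀.commutant Γ ∧
        (∃ hM : Sp (HeckeVN.dcosetFun Γ σ) * Φ X * star (Sp (HeckeVN.dcosetFun Γ σ)) ∈ M,
          (E ⟨_, hM⟩ : HeckeVN.L2 G L →L[ℂ] HeckeVN.L2 G L) = Φ (π₀.classicalHecke Γ σ X)) ∧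
        (σ⁻¹ ∈ HeckeVN.dcoset Γ σ →
          ∃ hM : Sp (HeckeVN.dcosetFun Γ σ) * Φ X * Sp (HeckeVN.dcosetFun Γ σ) ∈ M,
            (E ⟨_, hM⟩ : HeckeVN.L2 G L →L[ℂ] HeckeVN.L2 G L) =
              Φ (π₀.classicalHecke Γ σ X)) := by
  have hS : HeckeVN.IsSplitting π Γ L := ⟨hwand, hgen⟩
  refine ⟨HeckeVN.isStarProjection_cutProj hS hinv, HeckeVN.cutProj_mem hS hinv,
    fun X hX => HeckeVN.isSeries_commutantMap hS hinv hX, HeckeVN.bijOn_commutantMap hS hinv,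
    fun X hX Y hY a => ⟨HeckeVN.commutantMap_add hS hinv hX hY,
      HeckeVN.commutantMap_smul hS hinv a hX, HeckeVN.commutantMap_mul hS hinv hX hY,
      HeckeVN.commutantMap_star hS hinv hX⟩,
    fun f hf => ⟨HeckeVN.isSeries_splitHecke hS hΓ hf,
      HeckeVN.isSeries_reducedHecke hS hinv hΓ hf, HeckeVN.splitHecke_mem hS hΓ hf,
      HeckeVN.reducedHecke_mem hS hinv hΓ hf⟩,
    HeckeVN.reducedHecke_one hS hinv,
    fun f hf h hh a => ⟨HeckeVN.reducedHecke_add hS hinv hΓ hf hh,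
      HeckeVN.reducedHecke_smul hS hinv hΓ a hf, HeckeVN.reducedHecke_mul hS hinv hΓ hf hh,
      HeckeVN.reducedHecke_star hS hinv hΓ hf⟩,
    fun x hx => HeckeVN.exists_hasTrace hS hinv htr hx,
    HeckeVN.condExp hS hinv, HeckeVN.isCondExp_condExp hS hinv,
    fun E' hE' => HeckeVN.condExp_unique hS hinv htr (HeckeVN.isCondExp_condExp hS hinv) hE',
    fun σ X hX => ?_⟩
  have key := HeckeVN.condExp_reducedHecke_conj hS hinv hΓ σ hX
  refine ⟨key.1, key.2, fun hσ => ?_⟩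
  have h := key.2
  rwa [HeckeVN.star_reducedHecke_dcosetFun hS hinv hΓ hσ] at h
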